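/- Let $d\ge 2$, $\lambda>0$ and $\beta\in(0,1)$. There is a constant $C=C(d,\lambda,\beta)>0$ with the following property. Let $a$ and $a_0$ be measurable fields of symmetric matrices on $\mathbb{R}^d$ with $|\xi|^2\ge \xi\cdot a(x)\xi\ge\lambda|\xi|^2$ and $|\xi|^2\ge \xi\cdot a_0(x)\xi\ge\lambda|\xi|^2$ for all $x,\xi\in\mathbb{R}^d$. Let $a_h$ be a constant matrix and, for $i=1,\dots,d$, let $\phi_i\in H^1_{loc}(\mathbb{R}^d)$ be scalar fields and $\sigma_i=(\sigma_{ijk})_{j,k}$, $\sigma_{ijk}\in H^1_{loc}(\mathbb{R}^d)$, be skew-symmetric tensor fields such that, with $q_i:=a(e_i+\nabla\phi_i)$, $$q_i=a_he_i+\nabla\cdot\sigma_i,\qquad (\nabla\cdot\sigma_i)_j:=\sum_k\partial_k\sigma_{ijk},\qquad -\Delta\sigma_{ijk}=\partial_jq_{ik}-\partial_kq_{ij}.$$ Let $y\in\mathbb{R}^d$ and $R>0$, and set $a'=a_0$ in $B_R(y)$ and $a'=a$ outside of $B_R(y)$. Let $\phi_i',\sigma_{ijk}'\in H^1_{loc}(\mathbb{R}^d)$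 be such that, with $q_i':=a'(e_i+\nabla\phi_i')$, $$-\nabla\cdot a'(e_i+\nabla\phi'_i)=0,\qquad -\Delta\sigma_{ijk}'=\partial_jq'_{ik}-\partial_kq'_{ij},\qquad \int_{\mathbb{R}^d}|\nabla(\phi_i'-\phi_i)|^2<\infty,\qquad \int_{\mathbb{R}^d}|\nabla(\sigma_{ijk}'-\sigma_{ijk})|^2<\infty$$ (equations in the weak sense). For $z\in\mathbb{R}^d$ let $r_*(z)$ be the minimal radius (the infimum of all $\rho>0$) such that $$\frac1r\Big(\frac{1}{|B_r(z)|}\int_{B_r(z)}\Big|(\phi,\sigma)-\frac{1}{|B_r(z)|}\int_{B_r(z)}(\phi,\sigma)\Big|^2\Big)^{1/2}\le\Big(\frac{\rho}{r}\Big)^\beta\quad\text{for all } r\ge\rho,$$ where $(\phi,\sigma)$ is the collection of all components $\phi_i,\sigma_{ijk}$, and let $r_*'(z)$ be the same quantity for $(\phi',\sigma')$. Write $r_*=r_*(0)$ and $r_*'=r_*'(0)$. Suppose that such a $\rho$ exists for $(\phi,\sigma)$ both for $z=0$ and for $z=y$. Then such a $\rho$ exists for $(\phi',\sigma')$ for $z=0$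 and for $z=y$, and $$r_*'(y)+r_*'\le C\,(r_*(y)+r_*+R).$$ -/

import Mathlib

open MeasureTheory Set
open scoped ContDiff

/-- The Euclidean space `ℝ^d`. -/
abbrev Rd (d : ℕ) : Type := EuclideanSpace ℝ (Fin d)

/-- The classical partial derivative `∂_k η (x)`. -/
noncomputable def pd {d : ℕ} (k : Fin d) (η : Rd d → ℝ) (x : Rd d) : ℝ :=
  fderiv ℝ η x (EuclideanSpace.single k 1)

/-- Test functions: smooth and compactly supported functions on `ℝ^d`. -/
def IsTest {d : ℕ} (η : Rd d → ℝ) : Prop :=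
  ContDiff ℝ ∞ η ∧ HasCompactSupport η

/-- Locally square integrable functions. -/
def L2loc {d : ℕ} (f : Rd d → ℝ) : Prop :=
  ∀ K : Set (Rd d), IsCompact K → MemLp f 2 (volume.restrict K)

/-- Elements of `H¹_loc(ℝ^d)`: a locally square integrable function `toFun` together with its
weak partial derivatives `grad k = ∂_k toFun`, which are locally square integrable as well. -/
structure H1loc (d : ℕ) where
  toFun : Rd d → ℝ
  grad : Fin d → Rd d → ℝ
  toFun_L2loc : L2loc toFun
  grad_L2loc : ∀ k, L2loc (grad k)
  weak_grad : ∀ k, ∀ η : Rd d → ℝ, IsTest η →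
    ∫ x, toFun x * pd k η x = - ∫ x, grad k x * η x

/-- A measurable field of symmetric matrices that is uniformly elliptic:
`|ξ|² ≥ ξ · a(x) ξ ≥ lam |ξ|²` for all points `x` and vectors `ξ`. -/
structure IsCoefficientField {d : ℕ} (lam : ℝ) (a : Rd d → Matrix (Fin d) (Fin d) ℝ) : Prop where
  measurable : ∀ i j, Measurable fun x => a x i j
  symm : ∀ x, (a x).IsSymm
  upper : ∀ x, ∀ ξ : Fin d → ℝ, ∑ i, ∑ j, ξ i * a x i j * ξ j ≤ ∑ i, ξ i ^ 2
  lower : ∀ x, ∀ ξ : Fin d → ℝ, lam * ∑ i, ξ i ^ 2 ≤ ∑ i, ∑ j, ξ i * a x i j * ξ j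

open Classical in
/-- The medium with a defect: `a₀` in `B_R(y)` and `a` outside of `B_R(y)`. -/
noncomputable def defectMedium {d : ℕ} (a a₀ : Rd d → Matrix (Fin d) (Fin d) ℝ) (y : Rd d)
    (R : ℝ) (x : Rd d) : Matrix (Fin d) (Fin d) ℝ :=
  if x ∈ Metric.ball y R then a₀ x else a x

/-- The `j`-th component of the flux `q_i = a (e_i + ∇φ_i)`. -/
noncomputable def flux {d : ℕ} (a : Rd d → Matrix (Fin d) (Fin d) ℝ) (φ : Fin d → H1loc d)
    (i j : Fin d) (x : Rd d) : ℝ :=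
  ∑ l, a x j l * ((if l = i then 1 else 0) + (φ i).grad l x)

/-- The corrector equation `-∇·a(e_i + ∇φ_i) = 0` for all `i`, in the weak sense. -/
def SolvesCorrectorEq {d : ℕ} (a : Rd d → Matrix (Fin d) (Fin d) ℝ) (φ : Fin d → H1loc d) :
    Prop :=
  ∀ i, ∀ η : Rd d → ℝ, IsTest η → ∫ x, ∑ j, flux a φ i j x * pd j η x = 0

/-- The equation `-Δσ_{ijk} = ∂_j q_{ik} - ∂_k q_{ij}` with `q_i = a(e_i + ∇φ_i)` for all
`i, j, k`, in the weak sense. -/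
def SolvesGaugeEq {d : ℕ} (a : Rd d → Matrix (Fin d) (Fin d) ℝ) (φ : Fin d → H1loc d)
    (σ : Fin d → Fin d → Fin d → H1loc d) : Prop :=
  ∀ i j k, ∀ η : Rd d → ℝ, IsTest η →
    ∫ x, ∑ l, (σ i j k).grad l x * pd l η x =
      - ∫ x, (flux a φ i k x * pd j η x - flux a φ i j x * pd k η x)

/-- `(φ, σ)` is an augmented corrector for the coefficient field `a` and the homogenized
coefficient `ah`: every `σ_i` is skew-symmetric, `q_i = ah e_i + ∇·σ_i` where
`(∇·σ_i)_j = ∂_k σ_{ijk}`, and `σ` is in the gauge `-Δσ_{ijk} = ∂_j q_{ik} - ∂_k q_{ij}`. -/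
structure IsAugmentedCorrector {d : ℕ} (a : Rd d → Matrix (Fin d) (Fin d) ℝ)
    (ah : Matrix (Fin d) (Fin d) ℝ) (φ : Fin d → H1loc d)
    (σ : Fin d → Fin d → Fin d → H1loc d) : Prop where
  skew : ∀ i j k, ∀ᵐ x, (σ i j k).toFun x = - (σ i k j).toFun x
  flux_eq : ∀ i j, ∀ᵐ x, flux a φ i j x = ah j i + ∑ k, (σ i j k).grad k x
  gauge : SolvesGaugeEq a φ σ

/-- `u` and `v` behave in the same way at infinity: `∇(u - v)` is square integrable
on `ℝ^d`. -/
def SameAtInfinity {d : ℕ} (u v : H1loc d) : Prop :=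
  ∀ k, MemLp (fun x => u.grad k x - v.grad k x) 2 volume

/-- `(φ', σ')` is the augmented corrector for the perturbed medium `a'` which behaves at infinity
as the augmented corrector `(φ, σ)`. -/
structure IsPerturbedCorrector {d : ℕ} (a' : Rd d → Matrix (Fin d) (Fin d) ℝ)
    (φ : Fin d → H1loc d) (σ : Fin d → Fin d → Fin d → H1loc d)
    (φ' : Fin d → H1loc d) (σ' : Fin d → Fin d → Fin d → H1loc d) : Prop where
  corrector_eq : SolvesCorrectorEq a' φ'
  corrector_infty : ∀ i, SameAtInfinity (φ' i) (φ i)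
  gauge_eq : SolvesGaugeEq a' φ' σ'
  gauge_infty : ∀ i j k, SameAtInfinity (σ' i j k) (σ i j k)

/-- The average of `u` over the ball `B_r(z)`. -/
noncomputable def ballMean {d : ℕ} (u : H1loc d) (z : Rd d) (r : ℝ) : ℝ :=
  ⨍ x in Metric.ball z r, u.toFun x

/-- `(1/r) (⨍_{B_r(z)} |(φ,σ) - ⨍_{B_r(z)} (φ,σ)|²)^{1/2}`. -/
noncomputable def relOsc {d : ℕ} (φ : Fin d → H1loc d) (σ : Fin d → Fin d → Fin d → H1loc d)
    (z : Rd d) (r : ℝ) : ℝ :=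
  1 / r * √(⨍ x in Metric.ball z r,
    ((∑ i, ((φ i).toFun x - ballMean (φ i) z r) ^ 2) +
      ∑ i, ∑ j, ∑ k, ((σ i j k).toFun x - ballMean (σ i j k) z r) ^ 2))

/-- `ρ` is a radius from which on `(φ, σ)` grows `β`-sublinearly around `z`. -/
def IsSublinearRadius {d : ℕ} (β : ℝ) (φ : Fin d → H1loc d)
    (σ : Fin d → Fin d → Fin d → H1loc d) (z : Rd d) (ρ : ℝ) : Prop :=
  0 < ρ ∧ ∀ r : ℝ, ρ ≤ r → relOsc φ σ z r ≤ (ρ / r) ^ β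

/-- The minimal radius `r_*(z)`: the infimum of all `ρ > 0` as above. It is only used where such
`ρ` exist; it is zero exactly if moreover `(φ, σ)` is constant almost everywhere. -/
noncomputable def minimalRadius {d : ℕ} (β : ℝ) (φ : Fin d → H1loc d)
    (σ : Fin d → Fin d → Fin d → H1loc d) (z : Rd d) : ℝ :=
  sInf {ρ : ℝ | IsSublinearRadius β φ σ z ρ}

/-!
The perturbation `w` of any component of `(φ, σ)` has a gradient that is square integrable on the
whole space, with `∫ |∇w|² ≤ C s^d` for `s = r_*(y) + r_*(0) + R` (up to a multiple of `R`). By the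
Poincaré inequality the mean square oscillation of `w` in `B_r(z)` is then at most
`C r² (s / r)^d`, around every `z`. Since `d / 2 ≥ 1 > β`, this is at most `C r² (s / r)^{2β}` for
`r ≥ s`, so that it only changes the radius of `β`-sublinear growth by a constant factor
(`exists_isSublinearRadius_mul`).

For the energy bound, the flux difference is
`q'_i - q_i = a' ∇(φ'_i - φ_i) + (a' - a)(e_i + ∇φ_i)`. It is divergence free and square integrable,
hence orthogonal to `∇(φ'_i - φ_i)` (`integral_divFree_mul_grad_eq_zero_of_memLp`), and ellipticity
bounds the energy of `φ'_i - φ_i` by `∫_{B_R(y)} |e_i + ∇φ_i|²`. Caccioppoli's inequality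
(`exists_caccioppoli`) and sublinearity around `y` bound the latter by `C s^d`. The same
orthogonality applied to the gauge equation bounds the energy of `σ'_{ijk} - σ_{ijk}` by
`∫ |q'_i - q_i|²`.

Two facts on weak gradients carry this. A divergence-free field may be tested with compactly
supported `H¹` functions (`integral_divFree_mul_grad_eq_zero`). The Poincaré inequality
(`poincare_ball`) is needed only with the gradient on the whole space on the right-hand side; it
follows by averaging the bound `∫_{B_r(z)} |w(x + h) - w(x)|² dx ≤ |h|² ∫ |∇w|²` over `|h| ≤ 2r`.
-/

variable {d : ℕ}

/-! ### Square integrable functions and test functions -/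

/-- The Cauchy-Schwarz inequality in `L²`. -/
theorem sq_integral_mul_le {α : Type*} [MeasurableSpace α] {μ : Measure α} {f g : α → ℝ}
    (hf : MemLp f 2 μ) (hg : MemLp g 2 μ) :
    (∫ x, f x * g x ∂μ) ^ 2 ≤ (∫ x, f x ^ 2 ∂μ) * ∫ x, g x ^ 2 ∂μ := by
  have hff := hf.integrable_sq
  have hgg := hg.integrable_sq
  have hfg : Integrable (fun x => f x * g x) μ := hf.integrable_mul hg
  have key : ∀ t : ℝ, 0 ≤ (∫ x, f x ^ 2 ∂μ) * (t * t) + (2 * ∫ x, f x * g x ∂μ) * t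
      + ∫ x, g x ^ 2 ∂μ := by
    intro t
    have h0 : 0 ≤ ∫ x, (t * f x + g x) ^ 2 ∂μ := integral_nonneg fun x => sq_nonneg _
    have h1 : ∫ x, (t * f x + g x) ^ 2 ∂μ
        = ∫ x, ((t * t) * f x ^ 2 + (2 * t) * (f x * g x) + g x ^ 2) ∂μ := by
      congr 1; ext x; ring
    have h2 : Integrable (fun x => (t * t) * f x ^ 2 + (2 * t) * (f x * g x)) μ :=
      (hff.const_mul _).add (hfg.const_mul _)
    rw [h1, integral_add h2 hgg, integral_add (hff.const_mul _) (hfg.const_mul _),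
      integral_const_mul, integral_const_mul] at h0
    linarith
  have := discrim_le_zero key
  unfold discrim at this
  nlinarith

theorem L2loc.aestronglyMeasurable_restrict {f : Rd d → ℝ} (hf : L2loc f) {K : Set (Rd d)}
    (hK : IsCompact K) : AEStronglyMeasurable f (volume.restrict K) :=
  (hf K hK).aestronglyMeasurable

theorem L2loc.locallyIntegrable {f : Rd d → ℝ} (hf : L2loc f) : LocallyIntegrable f volume := by
  rw [locallyIntegrable_iff]
  intro K hK
  have : IsFiniteMeasure (volume.restrict K) := ⟨by simpa using hK.measure_lt_top⟩
  exact (hf K hK).integrable one_le_two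

theorem L2loc.aestronglyMeasurable {f : Rd d → ℝ} (hf : L2loc f) :
    AEStronglyMeasurable f volume :=
  hf.locallyIntegrable.aestronglyMeasurable

theorem MeasureTheory.MemLp.l2loc {f : Rd d → ℝ} (hf : MemLp f 2 volume) : L2loc f :=
  fun _ _ => hf.restrict _

theorem Continuous.l2loc {f : Rd d → ℝ} (hf : Continuous f) : L2loc f := by
  intro K hK
  have : IsFiniteMeasure (volume.restrict K) := ⟨by simpa using hK.measure_lt_top⟩
  obtain ⟨C, hC⟩ := hK.exists_bound_of_continuousOn hf.continuousOn
  refine MemLp.of_bound hf.aestronglyMeasurable C ?_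
  exact (ae_restrict_iff' hK.measurableSet).2 (Filter.Eventually.of_forall hC)

theorem L2loc.add {f g : Rd d → ℝ} (hf : L2loc f) (hg : L2loc g) :
    L2loc fun x => f x + g x := fun K hK => (hf K hK).add (hg K hK)

theorem L2loc.sub {f g : Rd d → ℝ} (hf : L2loc f) (hg : L2loc g) :
    L2loc fun x => f x - g x := fun K hK => (hf K hK).sub (hg K hK)

theorem L2loc.ball {f : Rd d → ℝ} (hf : L2loc f) (z : Rd d) (r : ℝ) :
    MemLp f 2 (volume.restrict (Metric.ball z r)) :=
  (hf _ (isCompact_closedBall z r)).mono_measure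
    (Measure.restrict_mono Metric.ball_subset_closedBall le_rfl)

theorem L2loc.sum {ι : Type*} (s : Finset ι) {f : ι → Rd d → ℝ} (hf : ∀ i, L2loc (f i)) :
    L2loc fun x => ∑ i ∈ s, f i x := fun K hK => memLp_finsetSum s fun i _ => hf i K hK

/-- Multiplication by a bounded measurable function preserves local square integrability. -/
theorem L2loc.bdd_mul {f m : Rd d → ℝ} (hf : L2loc f) (hm : AEStronglyMeasurable m volume)
    (C : ℝ) (hC : ∀ x, |m x| ≤ C) : L2loc fun x => m x * f x := fun K hK =>
  MemLp.of_le_mul (hf K hK) (hm.restrict.mul (hf.aestronglyMeasurable_restrict hK))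
    (c := C) (Filter.Eventually.of_forall fun x => by
      rw [norm_mul]; exact mul_le_mul_of_nonneg_right (hC x) (norm_nonneg _))

theorem L2loc.mul_continuous {f m : Rd d → ℝ} (hf : L2loc f) (hm : Continuous m) :
    L2loc fun x => m x * f x := by
  intro K hK
  obtain ⟨C, hC⟩ := hK.exists_bound_of_continuousOn hm.continuousOn
  refine MemLp.of_le_mul (hf K hK)
    (hm.aestronglyMeasurable.mul (hf.aestronglyMeasurable_restrict hK)) (c := C) ?_
  refine (ae_restrict_iff' hK.measurableSet).2 (Filter.Eventually.of_forall fun x hx => ?_)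
  rw [norm_mul]; exact mul_le_mul_of_nonneg_right (hC x hx) (norm_nonneg _)

/-- A locally square integrable function that vanishes off a compact set is square
integrable. -/
theorem L2loc.memLp_of_support {f : Rd d → ℝ} (hf : L2loc f) {K : Set (Rd d)} (hK : IsCompact K)
    (h : ∀ x, x ∉ K → f x = 0) : MemLp f 2 volume := by
  have h1 : K.indicator f = f := by
    ext x
    by_cases hx : x ∈ K
    · simp [hx]
    · simp [hx, h x hx]
  rw [← h1, memLp_indicator_iff_restrict hK.measurableSet]
  exact hf K hK

theorem L2loc.memLp_mul {f m : Rd d → ℝ} (hf : L2loc f) (hm : Continuous m)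
    (hs : HasCompactSupport m) : MemLp (fun x => m x * f x) 2 volume :=
  (hf.mul_continuous hm).memLp_of_support hs fun x hx => by
    rw [image_eq_zero_of_notMem_tsupport hx, zero_mul]

theorem L2loc.integrable_mul {f m : Rd d → ℝ} (hf : L2loc f) (hm : Continuous m)
    (hs : HasCompactSupport m) : Integrable (fun x => f x * m x) volume := by
  simpa [smul_eq_mul, mul_comm] using
    hf.locallyIntegrable.integrable_smul_left_of_hasCompactSupport hm hs

theorem L2loc.integrable_mul_of_support {f g : Rd d → ℝ} (hf : L2loc f) (hg : L2loc g)
    {K : Set (Rd d)} (hK : IsCompact K) (h : ∀ x, x ∉ K → g x = 0) :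
    Integrable (fun x => f x * g x) volume := by
  have h1 : MemLp (K.indicator f) 2 volume :=
    (memLp_indicator_iff_restrict hK.measurableSet).2 (hf K hK)
  refine (h1.integrable_mul (hg.memLp_of_support hK h)).congr
    (Filter.Eventually.of_forall fun x => ?_)
  by_cases hx : x ∈ K
  · simp [hx]
  · simp [h x hx]

theorem IsTest.continuous {η : Rd d → ℝ} (h : IsTest η) : Continuous η := h.1.continuous

theorem IsTest.differentiable {η : Rd d → ℝ} (h : IsTest η) : Differentiable ℝ η :=
  h.1.differentiable (by simp)

theorem ContDiff.pd {η : Rd d → ℝ} (h : ContDiff ℝ ∞ η) (k : Fin d) :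
    ContDiff ℝ ∞ (pd k η) := by
  have : ContDiff ℝ ∞ (fderiv ℝ η) := h.fderiv_right (by simp)
  exact this.clm_apply contDiff_const

theorem IsTest.pd {η : Rd d → ℝ} (h : IsTest η) (k : Fin d) : IsTest (pd k η) :=
  ⟨h.1.pd k, by
    have := h.2.fderiv_apply ℝ (EuclideanSpace.single k (1 : ℝ))
    exact this⟩

theorem IsTest.memLp {η : Rd d → ℝ} (h : IsTest η) : MemLp η 2 volume :=
  h.continuous.memLp_of_hasCompactSupport h.2

theorem IsTest.integrable {η : Rd d → ℝ} (h : IsTest η) : Integrable η volume :=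
  h.continuous.integrable_of_hasCompactSupport h.2

theorem IsTest.mul_contDiff {η f : Rd d → ℝ} (h : IsTest η) (hf : ContDiff ℝ ∞ f) :
    IsTest fun x => η x * f x := ⟨h.1.mul hf, h.2.mul_right⟩

/-- Reflecting and translating a test function gives a test function. -/
theorem IsTest.comp_const_sub {η : Rd d → ℝ} (h : IsTest η) (x : Rd d) :
    IsTest fun t => η (x - t) :=
  ⟨h.1.comp (contDiff_const.sub contDiff_id),
    h.2.comp_homeomorph (Homeomorph.subLeft x)⟩

theorem pd_comp_const_sub {η : Rd d → ℝ} (h : Differentiable ℝ η) (k : Fin d) (x t : Rd d) :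
    pd k (fun t => η (x - t)) t = - pd k η (x - t) := by
  have h1 : HasFDerivAt (fun t => η (x - t))
      ((fderiv ℝ η (x - t)).comp (-ContinuousLinearMap.id ℝ (Rd d))) t :=
    (h (x - t)).hasFDerivAt.comp t ((hasFDerivAt_id t).const_sub x)
  simp [pd, h1.fderiv]

theorem pd_mul {f g : Rd d → ℝ} (k : Fin d) {x : Rd d} (hf : DifferentiableAt ℝ f x)
    (hg : DifferentiableAt ℝ g x) :
    pd k (fun x => f x * g x) x = f x * pd k g x + g x * pd k f x := by
  unfold pd
  rw [fderiv_fun_mul hf hg]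
  simp

theorem integral_pd_eq_zero {η : Rd d → ℝ} (h : IsTest η) (k : Fin d) :
    ∫ x, pd k η x = 0 := by
  have := integral_mul_fderiv_eq_neg_fderiv_mul_of_integrable (μ := (volume : Measure (Rd d)))
    (f := fun _ : Rd d => (1 : ℝ)) (g := η) (v := EuclideanSpace.single k (1 : ℝ))
    (by simp) (by simpa [pd] using! (h.pd k).integrable) (by simpa using h.integrable)
    (fun x _ => differentiableAt_const _) (fun x _ => h.differentiable x)
  simpa [pd] using this

/-- The linear form `fderiv f x` in coordinates. -/
theorem fderiv_apply_eq_sum_pd (f : Rd d → ℝ) (x h : Rd d) :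
    fderiv ℝ f x h = ∑ k, h k * pd k f x := by
  have hh : h = ∑ k, h k • EuclideanSpace.single k (1 : ℝ) := by
    ext j
    simp [Pi.single_apply]
  conv_lhs => rw [hh]
  simp [pd]

/-- The difference of two elements of `H¹_loc`, with the difference of the given representatives of
the weak gradients. -/
noncomputable def H1loc.sub (u v : H1loc d) : H1loc d where
  toFun x := u.toFun x - v.toFun x
  grad k x := u.grad k x - v.grad k x
  toFun_L2loc := u.toFun_L2loc.sub v.toFun_L2loc
  grad_L2loc k := (u.grad_L2loc k).sub (v.grad_L2loc k)
  weak_grad k η hη := by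
    simp only [sub_mul]
    rw [integral_sub (u.toFun_L2loc.integrable_mul (hη.pd k).continuous (hη.pd k).2)
      (v.toFun_L2loc.integrable_mul (hη.pd k).continuous (hη.pd k).2),
      integral_sub ((u.grad_L2loc k).integrable_mul hη.continuous hη.2)
      ((v.grad_L2loc k).integrable_mul hη.continuous hη.2), u.weak_grad k η hη,
      v.weak_grad k η hη]
    ring

/-- The product `χ u` of `u ∈ H¹_loc` and a test function `χ`, with the weak gradient
`χ ∇u + u ∇χ`. -/
noncomputable def H1loc.mulTest (u : H1loc d) (χ : Rd d → ℝ) (hχ : IsTest χ) : H1loc d where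
  toFun x := χ x * u.toFun x
  grad k x := χ x * u.grad k x + pd k χ x * u.toFun x
  toFun_L2loc := u.toFun_L2loc.mul_continuous hχ.continuous
  grad_L2loc k := ((u.grad_L2loc k).mul_continuous hχ.continuous).add
    (u.toFun_L2loc.mul_continuous (hχ.pd k).continuous)
  weak_grad k η hη := by
    have h1 := u.weak_grad k _ (hχ.mul_contDiff hη.1)
    have hχη := hχ.mul_contDiff hη.1
    have hpη := hχ.mul_contDiff (hη.pd k).1
    have hpχ := (hχ.pd k).mul_contDiff hη.1
    have i1 := u.toFun_L2loc.integrable_mul hpη.continuous hpη.2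
    have i2 := u.toFun_L2loc.integrable_mul hpχ.continuous hpχ.2
    have i3 := (u.grad_L2loc k).integrable_mul hχη.continuous hχη.2
    have e1 : ∫ x, u.toFun x * pd k (fun x => χ x * η x) x
        = (∫ x, u.toFun x * (χ x * pd k η x)) + ∫ x, u.toFun x * (pd k χ x * η x) := by
      rw [← integral_add i1 i2]
      congr 1; ext x
      rw [pd_mul k (hχ.differentiable x) (hη.differentiable x)]; ring
    have e2 : ∫ x, χ x * u.toFun x * pd k η x = ∫ x, u.toFun x * (χ x * pd k η x) := by
      congr 1; ext x; ring
    have e3 : ∫ x, (χ x * u.grad k x + pd k χ x * u.toFun x) * η x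
        = (∫ x, u.grad k x * (χ x * η x)) + ∫ x, u.toFun x * (pd k χ x * η x) := by
      rw [← integral_add i3 i2]
      congr 1; ext x; ring
    rw [e2, e3]
    linarith

/-! ### Mollification of `H¹` functions -/

open scoped Convolution in
theorem integral_mul_comp_sub_eq_convolution (f ζ : Rd d → ℝ) :
    (fun x => ∫ t, f t * ζ (x - t)) = (f ⋆[ContinuousLinearMap.lsmul ℝ ℝ, volume] ζ) := by
  ext y; simp [convolution_def]

/-- Mollification commutes with the weak derivative: `∂_k (u ⋆ ζ) = (∂_k u) ⋆ ζ`. -/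
theorem H1loc.pd_convolution (u : H1loc d) {ζ : Rd d → ℝ} (hζ : IsTest ζ) (k : Fin d)
    (x : Rd d) :
    pd k (fun x => ∫ t, u.toFun t * ζ (x - t)) x = ∫ t, u.grad k t * ζ (x - t) := by
  have h1 := hζ.2.hasFDerivAt_convolution_right (ContinuousLinearMap.lsmul ℝ ℝ)
    u.toFun_L2loc.locallyIntegrable (hζ.1.of_le (by simp)) x
  unfold pd
  rw [integral_mul_comp_sub_eq_convolution, h1.fderiv,
    convolution_precompR_apply _ u.toFun_L2loc.locallyIntegrable
    (hζ.2.fderiv ℝ) (hζ.1.continuous_fderiv (by simp)), convolution_def]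
  have h3 := u.weak_grad k _ (hζ.comp_const_sub x)
  simp only [pd_comp_const_sub hζ.differentiable, mul_neg, integral_neg, neg_inj] at h3
  simpa [pd] using h3

theorem H1loc.contDiff_convolution (u : H1loc d) {ζ : Rd d → ℝ} (hζ : IsTest ζ) :
    ContDiff ℝ ∞ (fun x => ∫ t, u.toFun t * ζ (x - t)) := by
  rw [integral_mul_comp_sub_eq_convolution]
  exact hζ.2.contDiff_convolution_right (n := ⊤) _ u.toFun_L2loc.locallyIntegrable hζ.1

theorem H1loc.isTest_convolution (u : H1loc d) (hu : HasCompactSupport u.toFun) {ζ : Rd d → ℝ}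
    (hζ : IsTest ζ) : IsTest (fun x => ∫ t, u.toFun t * ζ (x - t)) := by
  refine ⟨u.contDiff_convolution hζ, ?_⟩
  rw [integral_mul_comp_sub_eq_convolution]
  exact hu.convolution _ hζ.2

/-! ### Testing a divergence-free field with `H¹` functions -/

theorem pd_eq_zero_of_notMem_tsupport {χ : Rd d → ℝ} (k : Fin d) {x : Rd d}
    (hx : x ∉ tsupport χ) : pd k χ x = 0 := by
  unfold pd
  rw [image_eq_zero_of_notMem_tsupport (f := fderiv ℝ χ)
    (fun h => hx (tsupport_fderiv_subset ℝ h))]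
  simp

theorem H1loc.mulTest_grad_eq_zero (u : H1loc d) {χ : Rd d → ℝ} (hχ : IsTest χ) (k : Fin d)
    (x : Rd d) (hx : x ∉ tsupport χ) : (u.mulTest χ hχ).grad k x = 0 := by
  simp [H1loc.mulTest, image_eq_zero_of_notMem_tsupport hx, pd_eq_zero_of_notMem_tsupport k hx]

/-- The correlation of two square integrable functions is continuous. -/
theorem continuous_integral_mul_comp_sub {f g : Rd d → ℝ} (hf : MemLp f 2 volume)
    (hg : MemLp g 2 volume) : Continuous fun h => ∫ x, f x * g (x - h) := by
  have hmp : ∀ h : Rd d, MeasurePreserving (ContinuousMap.mk (fun x : Rd d => x - h)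
      (by fun_prop)) volume volume := fun h => measurePreserving_sub_right volume h
  have hg' : Continuous fun h : Rd d => ContinuousMap.mk (fun x : Rd d => x - h)
      (by fun_prop) := by
    let F : C(Rd d × Rd d, Rd d) := ⟨fun p => p.2 - p.1, by fun_prop⟩
    exact F.curry.continuous
  have hc : Continuous fun h : Rd d => Lp.compMeasurePreserving _ (hmp h) (hg.toLp g) :=
    Continuous.compMeasurePreservingLp continuous_const hg' hmp (by simp)
  have hi : Continuous fun h : Rd d =>
      inner ℝ (Lp.compMeasurePreserving _ (hmp h) (hg.toLp g)) (hf.toLp f) := by fun_prop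
  convert hi using 2 with h
  rw [L2.inner_def]
  refine integral_congr_ae ?_
  have h1 := Lp.coeFn_compMeasurePreserving (hg.toLp g) (hmp h)
  have h2 := (hmp h).quasiMeasurePreserving.ae_eq_comp hg.coeFn_toLp
  filter_upwards [h1, h2, hf.coeFn_toLp] with x h1 h2 h3
  rw [h1, h2, h3]
  simp

theorem integrable_correlation_mul {f g ζ : Rd d → ℝ} (hf : Integrable f) (hg : Integrable g)
    (hζ : IsTest ζ) : Integrable (fun p : Rd d × Rd d => ζ p.1 * (f p.2 * g (p.2 - p.1)))
      (volume.prod volume) := by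
  have h1 := hf.convolution_integrand (ContinuousLinearMap.lsmul ℝ ℝ) hg.comp_neg
  obtain ⟨C, hC⟩ := hζ.2.exists_bound_of_continuous hζ.continuous
  refine (h1.bdd_mul (f := fun p : Rd d × Rd d => ζ p.1) (c := C)
    (hζ.continuous.comp continuous_fst).aestronglyMeasurable
    (Filter.Eventually.of_forall fun p => hC p.1)).congr ?_
  refine Filter.Eventually.of_forall fun p => ?_
  simp

open scoped Pointwise in
/-- A weakly divergence-free field is orthogonal to the gradient of a compactly supported
`H¹` function. The correlation `H h = ∑ k, ∫ q_k(x) ∂_k v(x - h)` vanishes in the weak sense near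
`h = 0`, since `v ⋆ ζ` is a test function for every test function `ζ`; being continuous, it
vanishes at `h = 0`. -/
theorem integral_divFree_mul_grad_eq_zero {q : Fin d → Rd d → ℝ} (hq : ∀ k, L2loc (q k))
    (hdiv : ∀ η : Rd d → ℝ, IsTest η → ∫ x, ∑ k, q k x * pd k η x = 0)
    (v : H1loc d) {K : Set (Rd d)} (hK : IsCompact K) (hv : ∀ x, x ∉ K → v.toFun x = 0)
    (hgv : ∀ k x, x ∉ K → v.grad k x = 0) :
    ∫ x, ∑ k, q k x * v.grad k x = 0 := by
  set K' : Set (Rd d) := K + Metric.closedBall 0 1 with hK'def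
  have hK' : IsCompact K' := hK.add (isCompact_closedBall 0 1)
  have hKK' : K ⊆ K' := fun x hx => ⟨x, hx, 0, by simp, by simp⟩
  set Q : Fin d → Rd d → ℝ := fun k => K'.indicator (q k) with hQ
  have hQ2 : ∀ k, MemLp (Q k) 2 volume := fun k =>
    (memLp_indicator_iff_restrict hK'.measurableSet).2 (hq k K' hK')
  have hQ1 : ∀ k, Integrable (Q k) volume := fun k =>
    (integrable_indicator_iff hK'.measurableSet).2
      ((hq k).locallyIntegrable.integrableOn_isCompact hK')
  have hG2 : ∀ k, MemLp (v.grad k) 2 volume := fun k =>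
    (v.grad_L2loc k).memLp_of_support hK (hgv k)
  have hG1 : ∀ k, Integrable (v.grad k) volume := fun k =>
    (integrableOn_iff_integrable_of_support_subset (s := K) (fun x hx => by
      by_contra h; exact hx (hgv k x h))).1
      ((v.grad_L2loc k).locallyIntegrable.integrableOn_isCompact hK)
  have hvc : HasCompactSupport v.toFun := HasCompactSupport.intro hK hv
  set H : Rd d → ℝ := fun h => ∑ k, ∫ x, Q k x * v.grad k (x - h) with hH
  have hHc : Continuous H := continuous_finsetSum _ fun k _ =>
    continuous_integral_mul_comp_sub (hQ2 k) (hG2 k)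
  have hH0 : ∀ ζ : Rd d → ℝ, ContDiff ℝ ∞ ζ → HasCompactSupport ζ →
      tsupport ζ ⊆ Metric.ball 0 1 → ∫ h, ζ h • H h = 0 := by
    intro ζ h1 h2 hs
    have hζ : IsTest ζ := ⟨h1, h2⟩
    set V : Rd d → ℝ := fun x => ∫ t, v.toFun t * ζ (x - t) with hVdef
    have hV : IsTest V := v.isTest_convolution hvc hζ
    have hpV : ∀ k x, pd k V x = ∫ t, v.grad k t * ζ (x - t) := fun k x =>
      v.pd_convolution hζ k x
    have hpV0 : ∀ k x, x ∉ K' → pd k V x = 0 := by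
      intro k x hx
      rw [hpV]
      refine integral_eq_zero_of_ae (Filter.Eventually.of_forall fun t => ?_)
      by_cases ht : t ∈ K
      · by_cases hxt : x - t ∈ tsupport ζ
        · exact absurd ⟨t, ht, x - t, Metric.ball_subset_closedBall (hs hxt), by simp⟩ hx
        · simp [image_eq_zero_of_notMem_tsupport hxt]
      · simp [hgv k t ht]
    have hint : ∀ k, Integrable (fun x => q k x * pd k V x) volume := fun k =>
      (hq k).integrable_mul (hV.pd k).continuous (hV.pd k).2
    have hsum := hdiv V hV
    rw [integral_finsetSum _ fun k _ => hint k] at hsum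
    have hfub : ∀ k, ∫ h, ζ h * ∫ x, Q k x * v.grad k (x - h) = ∫ x, q k x * pd k V x := by
      intro k
      simp_rw [← integral_const_mul]
      rw [integral_integral_swap (integrable_correlation_mul (hQ1 k) (hG1 k) hζ)]
      refine integral_congr_ae (Filter.Eventually.of_forall fun x => ?_)
      have e1 : ∫ h, ζ h * (Q k x * v.grad k (x - h)) = Q k x * pd k V x := by
        rw [hpV, ← integral_sub_left_eq_self _ volume x, ← integral_const_mul]
        congr 1; ext h
        rw [sub_sub_cancel]; ring
      simp only [e1]
      by_cases hx : x ∈ K'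
      · simp [hQ, hx]
      · simp [hpV0 k x hx]
    have hcint : ∀ k, Integrable (fun h => ζ h * ∫ x, Q k x * v.grad k (x - h)) volume :=
      fun k => (Continuous.mul hζ.continuous
        (continuous_integral_mul_comp_sub (hQ2 k) (hG2 k))).integrable_of_hasCompactSupport
          h2.mul_right
    simp only [smul_eq_mul, hH, Finset.mul_sum]
    rw [integral_finsetSum _ fun k _ => hcint k, ← hsum]
    exact Finset.sum_congr rfl fun k _ => hfub k
  have hae := Metric.isOpen_ball.ae_eq_zero_of_integral_contDiff_smul_eq_zero
    (hHc.locallyIntegrable.locallyIntegrableOn (Metric.ball (0 : Rd d) 1)) hH0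
  have hzero : H 0 = 0 := by
    have := Measure.eqOn_open_of_ae_eq (μ := (volume : Measure (Rd d)))
      (f := H) (g := fun _ => (0 : ℝ))
      ((ae_restrict_iff' Metric.isOpen_ball.measurableSet).2 hae)
      Metric.isOpen_ball hHc.continuousOn continuousOn_const
    exact this (Metric.mem_ball_self one_pos)
  have hint : ∀ k, Integrable (fun x => q k x * v.grad k x) volume := fun k =>
    (hq k).integrable_mul_of_support (v.grad_L2loc k) hK (hgv k)
  rw [integral_finsetSum _ fun k _ => hint k, ← hzero]
  simp only [hH, sub_zero]
  refine Finset.sum_congr rfl fun k _ => integral_congr_ae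
    (Filter.Eventually.of_forall fun x => ?_)
  by_cases hx : x ∈ K
  · simp [hQ, hKK' hx]
  · simp [hgv k x hx]

/-- A weakly divergence-free field can be tested with `χ (u - c)` for `u ∈ H¹_loc`, a constant
`c` and a cutoff `χ`. -/
theorem integral_divFree_mul_cutoff_eq_zero {q : Fin d → Rd d → ℝ} (hq : ∀ k, L2loc (q k))
    (hdiv : ∀ η : Rd d → ℝ, IsTest η → ∫ x, ∑ k, q k x * pd k η x = 0)
    (u : H1loc d) (c : ℝ) {χ : Rd d → ℝ} (hχ : IsTest χ) :
    ∫ x, ∑ k, q k x * (χ x * u.grad k x + pd k χ x * (u.toFun x - c)) = 0 := by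
  have h1 := integral_divFree_mul_grad_eq_zero hq hdiv (u.mulTest χ hχ) hχ.2
    (fun x hx => by simp [H1loc.mulTest, image_eq_zero_of_notMem_tsupport hx])
    (u.mulTest_grad_eq_zero hχ)
  have h2 := hdiv χ hχ
  have i1 : Integrable (fun x => ∑ k, q k x * pd k χ x) := integrable_finsetSum _ fun k _ =>
    (hq k).integrable_mul (hχ.pd k).continuous (hχ.pd k).2
  have i2 : Integrable (fun x => ∑ k, q k x * (u.mulTest χ hχ).grad k x) :=
    integrable_finsetSum _ fun k _ => (hq k).integrable_mul_of_support
      ((u.mulTest χ hχ).grad_L2loc k) hχ.2 (u.mulTest_grad_eq_zero hχ k)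
  have h3 : ∀ x, ∑ k, q k x * (χ x * u.grad k x + pd k χ x * (u.toFun x - c))
      = ∑ k, q k x * (u.mulTest χ hχ).grad k x - c * ∑ k, q k x * pd k χ x := by
    intro x
    rw [Finset.mul_sum, ← Finset.sum_sub_distrib]
    refine Finset.sum_congr rfl fun k _ => ?_
    simp only [H1loc.mulTest]
    ring
  simp_rw [h3]
  rw [integral_sub i2 (i1.const_mul c), integral_const_mul, h1, h2]
  simp

/-! ### A Poincaré inequality for functions with globally square integrable gradient -/

/-- Smooth cutoffs between `B_s(z)` and `B_{2s}(z)` whose derivatives are bounded by `M / s`, with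
`M` independent of `z` and `s`. -/
theorem exists_cutoff (d : ℕ) : ∃ M : ℝ, 0 < M ∧ ∀ (z : Rd d) (s : ℝ), 0 < s →
    ∃ χ : Rd d → ℝ, IsTest χ ∧ (∀ x, 0 ≤ χ x) ∧ (∀ x, χ x ≤ 1) ∧
      (∀ x ∈ Metric.ball z s, χ x = 1) ∧ (∀ x, x ∉ Metric.ball z (2 * s) → χ x = 0) ∧
      ∀ k x, |pd k χ x| ≤ M / s := by
  let f : ContDiffBump (0 : Rd d) := ⟨1, 2, one_pos, one_lt_two⟩
  have hf : IsTest (f : Rd d → ℝ) := ⟨f.contDiff, f.hasCompactSupport⟩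
  have hb : ∀ k, ∃ C : ℝ, ∀ x, ‖pd k f x‖ ≤ C := fun k =>
    (hf.pd k).2.exists_bound_of_continuous (hf.pd k).continuous
  choose C hC using hb
  refine ⟨∑ k, |C k| + 1, by positivity, fun z s hs => ?_⟩
  have hn : ∀ x : Rd d, ‖s⁻¹ • (x - z)‖ = dist x z / s := fun x => by
    rw [norm_smul, norm_inv, Real.norm_of_nonneg hs.le, dist_eq_norm]; ring
  refine ⟨fun x => f (s⁻¹ • (x - z)), ⟨?_, ?_⟩, fun x => f.nonneg, fun x => f.le_one, ?_, ?_, ?_⟩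
  · exact f.contDiff.comp (by fun_prop : ContDiff ℝ ∞ fun x : Rd d => s⁻¹ • (x - z))
  · refine HasCompactSupport.intro (isCompact_closedBall z (2 * s)) fun x hx => ?_
    refine f.zero_of_le_dist ?_
    rw [dist_zero_right, hn]
    rw [Metric.mem_closedBall, not_le] at hx
    change 2 ≤ _
    rw [le_div_iff₀ hs]
    exact hx.le
  · intro x hx
    refine f.one_of_mem_closedBall ?_
    rw [mem_closedBall_zero_iff, hn]
    change _ ≤ 1
    rw [div_le_one hs]
    exact (Metric.mem_ball.1 hx).le
  · intro x hx
    refine f.zero_of_le_dist ?_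
    rw [dist_zero_right, hn]
    rw [Metric.mem_ball, not_lt] at hx
    change 2 ≤ _
    rw [le_div_iff₀ hs]
    exact hx
  · intro k x
    have h0 : HasFDerivAt (fun x : Rd d => s⁻¹ • (x - z))
        (s⁻¹ • ContinuousLinearMap.id ℝ (Rd d)) x :=
      ((hasFDerivAt_id x).sub_const z).const_smul s⁻¹
    have h1 : HasFDerivAt (fun x => f (s⁻¹ • (x - z)))
        ((fderiv ℝ f (s⁻¹ • (x - z))).comp (s⁻¹ • ContinuousLinearMap.id ℝ (Rd d))) x :=
      HasFDerivAt.comp (g := (f : Rd d → ℝ)) x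
        (hf.differentiable (s⁻¹ • (x - z))).hasFDerivAt h0
    have h2 : pd k (fun x => f (s⁻¹ • (x - z))) x = s⁻¹ * pd k f (s⁻¹ • (x - z)) := by
      simp [pd, h1.fderiv]
    rw [h2, abs_mul, abs_of_pos (inv_pos.2 hs), div_eq_inv_mul]
    refine mul_le_mul_of_nonneg_left ?_ (inv_pos.2 hs).le
    have h3 : |C k| ≤ ∑ k, |C k| :=
      Finset.single_le_sum (f := fun k => |C k|) (fun i _ => abs_nonneg _) (Finset.mem_univ k)
    have h4 := hC k (s⁻¹ • (x - z))
    rw [Real.norm_eq_abs] at h4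
    linarith [le_abs_self (C k)]

/-- The energy `∫ |∇w|²` over the whole space. -/
noncomputable def dirichletEnergy (w : H1loc d) : ℝ := ∑ k, ∫ x, w.grad k x ^ 2

theorem dirichletEnergy_nonneg (w : H1loc d) : 0 ≤ dirichletEnergy w :=
  Finset.sum_nonneg fun _ _ => integral_nonneg fun _ => sq_nonneg _

theorem L2loc.comp_add_right {f : Rd d → ℝ} (hf : L2loc f) (h : Rd d) :
    L2loc fun x => f (x + h) := by
  intro K hK
  have hK2 : IsCompact ((fun x => x + h) '' K) := hK.image (by fun_prop)
  have hmp := (measurePreserving_add_right (volume : Measure (Rd d)) h).restrict_preimage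
    hK2.measurableSet
  rw [preimage_image_eq _ (add_left_injective h)] at hmp
  exact (hf _ hK2).comp_measurePreserving hmp

/-- Difference quotients of `w` are controlled by the gradient, in duality with test functions:
apply the mean value inequality to the mollification of `w` by the reflected test function. -/
theorem sq_integral_diff_mul_le (w : H1loc d) (hw : ∀ k, MemLp (w.grad k) 2 volume)
    (h : Rd d) {η : Rd d → ℝ} (hη : IsTest η) :
    (∫ x, (w.toFun (x + h) - w.toFun x) * η x) ^ 2
      ≤ ‖h‖ ^ 2 * dirichletEnergy w * ∫ x, η x ^ 2 := by
  have hζ : IsTest fun t => η (0 - t) := hη.comp_const_sub 0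
  set W : Rd d → ℝ := fun x => ∫ t, w.toFun t * (fun t => η (0 - t)) (x - t) with hW
  have hWd : ContDiff ℝ ∞ W := w.contDiff_convolution hζ
  have hWx : ∀ x, W x = ∫ t, w.toFun (t + x) * η t := by
    intro x
    rw [hW]
    simp only
    rw [← integral_add_right_eq_self _ x]
    congr 1; ext t; congr 2; abel
  have hpd : ∀ k x, (pd k W x) ^ 2 ≤ (∫ t, w.grad k t ^ 2) * ∫ t, η t ^ 2 := by
    intro k x
    rw [w.pd_convolution hζ k x]
    refine (sq_integral_mul_le (hw k) (hζ.comp_const_sub x).memLp).trans_eq ?_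
    congr 1
    rw [← integral_sub_right_eq_self (fun t => η t ^ 2) x]
    congr 1; ext t; congr 2; abel
  set N := ∫ x, η x ^ 2
  have hN : 0 ≤ N := integral_nonneg fun _ => sq_nonneg _
  have hfd : ∀ x, |fderiv ℝ W x h| ≤ √(‖h‖ ^ 2 * dirichletEnergy w * N) := by
    intro x
    refine Real.abs_le_sqrt ?_
    rw [fderiv_apply_eq_sum_pd]
    refine (Finset.sum_mul_sq_le_sq_mul_sq _ _ _).trans ?_
    rw [mul_assoc, EuclideanSpace.norm_sq_eq]
    simp only [Real.norm_eq_abs, sq_abs]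
    refine mul_le_mul_of_nonneg_left ?_ (Finset.sum_nonneg fun _ _ => sq_nonneg _)
    rw [dirichletEnergy, Finset.sum_mul]
    exact Finset.sum_le_sum fun k _ => hpd k x
  have hmv : |W h - W 0| ≤ √(‖h‖ ^ 2 * dirichletEnergy w * N) := by
    have hder : ∀ t ∈ Icc (0 : ℝ) 1, HasDerivWithinAt (fun t : ℝ => W (t • h))
        (fderiv ℝ W (t • h) h) (Icc 0 1) t := by
      intro t _
      have h1 : HasDerivAt (fun t : ℝ => t • h) h t := by
        simpa using (hasDerivAt_id t).smul_const h
      exact ((hWd.differentiable (by simp) (t • h)).hasFDerivAt.comp_hasDerivAt t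
        h1).hasDerivWithinAt
    have := norm_image_sub_le_of_norm_deriv_le_segment_01' hder (fun t _ => hfd (t • h))
    simpa using this
  have hdiff : ∫ x, (w.toFun (x + h) - w.toFun x) * η x = W h - W 0 := by
    rw [hWx, hWx, ← integral_sub
      ((w.toFun_L2loc.comp_add_right h).integrable_mul hη.continuous hη.2)
      ((w.toFun_L2loc.comp_add_right 0).integrable_mul hη.continuous hη.2)]
    congr 1; ext x; simp [sub_mul]
  rw [hdiff, ← sq_abs]
  refine (pow_le_pow_left₀ (abs_nonneg _) hmv 2).trans_eq (Real.sq_sqrt ?_)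
  exact mul_nonneg (mul_nonneg (sq_nonneg _) (dirichletEnergy_nonneg w)) hN

theorem norm_toLp_sq_eq_integral {f : Rd d → ℝ} (hf : MemLp f 2 volume) :
    ‖hf.toLp f‖ ^ 2 = ∫ x, f x ^ 2 := by
  rw [← real_inner_self_eq_norm_sq, L2.inner_def]
  refine integral_congr_ae ?_
  filter_upwards [hf.coeFn_toLp] with x hx
  rw [hx]; simp [sq]

/-- A function bounded in duality with test functions is square integrable with the same
bound. -/
theorem setIntegral_sq_le_of_forall_test {f : Rd d → ℝ} (hf : L2loc f) {A : ℝ}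
    (h : ∀ η : Rd d → ℝ, IsTest η → (∫ x, f x * η x) ^ 2 ≤ A * ∫ x, η x ^ 2)
    (hA : 0 ≤ A) (z : Rd d) {r : ℝ} (hr : 0 < r) : ∫ x in Metric.ball z r, f x ^ 2 ≤ A := by
  obtain ⟨M, -, hM⟩ := exists_cutoff d
  obtain ⟨χ, hχ, hχ0, hχ1, hχB, -, -⟩ := hM z r hr
  have hg : MemLp (fun x => χ x * f x) 2 volume := hf.memLp_mul hχ.continuous hχ.2
  set G := hg.toLp _ with hG
  have key : ∀ F : Lp ℝ 2 (volume : Measure (Rd d)), (inner ℝ F G) ^ 2 ≤ A * ‖F‖ ^ 2 := by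
    intro F
    refine (Lp.dense_hasCompactSupport_contDiff (F := ℝ) (μ := (volume : Measure (Rd d)))
      (p := 2) (by simp)).induction (P := fun F => (inner ℝ F G) ^ 2 ≤ A * ‖F‖ ^ 2) ?_ ?_ F
    · rintro F ⟨η, hFη, hη2, hη1⟩
      have hη : IsTest η := ⟨hη1, hη2⟩
      have hFL : F = hη.memLp.toLp η := Lp.ext (hFη.trans hη.memLp.coeFn_toLp.symm)
      have e1 : inner ℝ F G = ∫ x, f x * (χ x * η x) := by
        rw [L2.inner_def]
        refine integral_congr_ae ?_
        filter_upwards [hFη, hg.coeFn_toLp] with x h1 h2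
        rw [h1, hG, h2]
        simp; ring
      rw [e1, hFL, norm_toLp_sq_eq_integral]
      refine (h _ (hχ.mul_contDiff hη.1)).trans (mul_le_mul_of_nonneg_left ?_ hA)
      refine integral_mono (hχ.mul_contDiff hη.1).memLp.integrable_sq hη.memLp.integrable_sq
        fun x => ?_
      have : χ x ^ 2 ≤ 1 := pow_le_one₀ (hχ0 x) (hχ1 x)
      simp only [mul_pow]
      nlinarith [sq_nonneg (η x)]
    · exact isClosed_le (by fun_prop) (by fun_prop)
  have hGG := key G
  rw [real_inner_self_eq_norm_sq] at hGG
  have hle : ‖G‖ ^ 2 ≤ A := by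
    by_contra hlt
    rw [not_le] at hlt
    nlinarith [hA.trans_lt hlt]
  calc ∫ x in Metric.ball z r, f x ^ 2
      = ∫ x in Metric.ball z r, (χ x * f x) ^ 2 :=
        setIntegral_congr_fun Metric.isOpen_ball.measurableSet fun x hx => by simp [hχB x hx]
    _ ≤ ∫ x, (χ x * f x) ^ 2 :=
        setIntegral_le_integral hg.integrable_sq (Filter.Eventually.of_forall fun _ => sq_nonneg _)
    _ = ‖G‖ ^ 2 := (norm_toLp_sq_eq_integral hg).symm
    _ ≤ A := hle

/-- Difference quotients of `w` are controlled by the gradient in `L²`. -/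
theorem setIntegral_sq_diff_le (w : H1loc d) (hw : ∀ k, MemLp (w.grad k) 2 volume)
    (h z : Rd d) {r : ℝ} (hr : 0 < r) :
    ∫ x in Metric.ball z r, (w.toFun (x + h) - w.toFun x) ^ 2 ≤ ‖h‖ ^ 2 * dirichletEnergy w :=
  setIntegral_sq_le_of_forall_test ((w.toFun_L2loc.comp_add_right h).sub w.toFun_L2loc)
    (fun _ hη => sq_integral_diff_mul_le w hw h hη)
    (mul_nonneg (sq_nonneg _) (dirichletEnergy_nonneg w)) z hr

theorem volume_real_ball_pos (z : Rd d) {r : ℝ} (hr : 0 < r) :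
    0 < volume.real (Metric.ball z r) :=
  ENNReal.toReal_pos (Metric.measure_ball_pos _ _ hr).ne' measure_ball_lt_top.ne

theorem volume_real_ball (z : Rd d) {r : ℝ} (hr : 0 < r) :
    volume.real (Metric.ball z r) = r ^ d * volume.real (Metric.ball (0 : Rd d) 1) := by
  rw [Measure.real, Measure.addHaar_ball_of_pos _ _ hr, ENNReal.toReal_mul,
    ENNReal.toReal_ofReal (by positivity)]
  simp [Measure.real]

theorem ballMean_eq (w : H1loc d) (z : Rd d) (r : ℝ) :
    ballMean w z r = (volume.real (Metric.ball z r))⁻¹ * ∫ x in Metric.ball z r, w.toFun x := by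
  simp [ballMean, setAverage_eq]

/-- The Poincaré inequality for a Borel measurable representative. Up to the factor `2 |B_r|`, the
left-hand side is the double integral of `|w(x) - w(y)|²` over `B_r(z) × B_r(z)`; substitute
`y = x + h` with `|h| < 2r` and exchange the integrals. -/
theorem poincare_ball_of_measurable (w : H1loc d) (hw : ∀ k, MemLp (w.grad k) 2 volume)
    (hm : Measurable w.toFun) (z : Rd d) {r : ℝ} (hr : 0 < r) :
    ∫ x in Metric.ball z r, (w.toFun x - ballMean w z r) ^ 2
      ≤ 2 * 2 ^ d * r ^ 2 * dirichletEnergy w := by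
  set u := w.toFun with hu
  set B := Metric.ball z r with hB
  set m := volume.real B with hmdef
  have hmpos : 0 < m := volume_real_ball_pos z hr
  have hfin : IsFiniteMeasure (volume.restrict B) := ⟨by
    simpa [hB] using measure_ball_lt_top⟩
  have hL : MemLp u 2 (volume.restrict B) := w.toFun_L2loc.ball z r
  have h1 : Integrable u (volume.restrict B) := hL.integrable one_le_two
  have h2 : Integrable (fun x => u x ^ 2) (volume.restrict B) := hL.integrable_sq
  set I1 := ∫ x in B, u x with hI1
  set I2 := ∫ x in B, u x ^ 2 with hI2
  have expand : ∀ c : ℝ, ∫ y in B, (u y - c) ^ 2 = I2 - 2 * c * I1 + m * c ^ 2 := by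
    intro c
    have e : ∀ y, (u y - c) ^ 2 = u y ^ 2 - 2 * c * u y + c ^ 2 := fun y => by ring
    simp_rw [e]
    have i3 : Integrable (fun y => u y ^ 2 - 2 * c * u y) (volume.restrict B) :=
      h2.sub (h1.const_mul _)
    rw [integral_add i3 (integrable_const _), integral_sub h2 (h1.const_mul _),
      integral_const_mul, integral_const]
    simp only [measureReal_restrict_apply_univ, smul_eq_mul]
    rfl
  have hLHS : ∫ x in B, (u x - ballMean w z r) ^ 2 = I2 - I1 ^ 2 / m := by
    rw [expand, ballMean_eq]
    change I2 - 2 * (m⁻¹ * I1) * I1 + m * (m⁻¹ * I1) ^ 2 = _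
    field_simp
    ring
  have hinner : ∀ x, ∫⁻ y in B, ENNReal.ofReal ((u y - u x) ^ 2)
      = ENNReal.ofReal (I2 - 2 * u x * I1 + m * u x ^ 2) := by
    intro x
    have hint : Integrable (fun y => (u y - u x) ^ 2) (volume.restrict B) :=
      (hL.sub (memLp_const (u x))).integrable_sq
    rw [← expand (u x), ofReal_integral_eq_lintegral_ofReal hint
      (Filter.Eventually.of_forall fun y => sq_nonneg _)]
  have hJ : ∫⁻ x in B, ∫⁻ y in B, ENNReal.ofReal ((u y - u x) ^ 2)
      = ENNReal.ofReal (2 * m * I2 - 2 * I1 ^ 2) := by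
    simp_rw [hinner]
    have i1 : Integrable (fun x => I2 - 2 * u x * I1) (volume.restrict B) :=
      (integrable_const _).sub ((h1.const_mul 2).mul_const I1)
    have i2 : Integrable (fun x => I2 - 2 * u x * I1 + m * u x ^ 2) (volume.restrict B) :=
      i1.add (h2.const_mul m)
    rw [← ofReal_integral_eq_lintegral_ofReal i2]
    · congr 1
      rw [integral_add i1 (h2.const_mul m), integral_sub (integrable_const _)
        ((h1.const_mul 2).mul_const I1), integral_const, integral_mul_const, integral_const_mul,
        integral_const_mul]
      simp only [measureReal_restrict_apply_univ, smul_eq_mul]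
      ring
    · refine Filter.Eventually.of_forall fun x => ?_
      change 0 ≤ I2 - 2 * u x * I1 + m * u x ^ 2
      rw [← expand]
      exact integral_nonneg fun _ => sq_nonneg _
  have hle : ∫⁻ x in B, ∫⁻ y in B, ENNReal.ofReal ((u y - u x) ^ 2)
      ≤ ENNReal.ofReal (2 ^ d * m * (4 * r ^ 2 * dirichletEnergy w)) := by
    calc ∫⁻ x in B, ∫⁻ y in B, ENNReal.ofReal ((u y - u x) ^ 2)
        ≤ ∫⁻ x in B, ∫⁻ h in Metric.ball (0 : Rd d) (2 * r),
            ENNReal.ofReal ((u (x + h) - u x) ^ 2) := by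
          refine setLIntegral_mono' Metric.isOpen_ball.measurableSet fun x hx => ?_
          rw [← lintegral_indicator Metric.isOpen_ball.measurableSet,
            ← lintegral_indicator Metric.isOpen_ball.measurableSet,
            ← lintegral_add_left_eq_self _ x]
          refine lintegral_mono fun h => ?_
          by_cases hxh : x + h ∈ B
          · have : h ∈ Metric.ball (0 : Rd d) (2 * r) := by
              rw [mem_ball_zero_iff]
              have e : h = (x + h - z) - (x - z) := by abel
              rw [e]
              refine (norm_sub_le _ _).trans_lt ?_
              rw [← dist_eq_norm, ← dist_eq_norm]
              have := Metric.mem_ball.1 hxh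
              have := Metric.mem_ball.1 hx
              linarith
            rw [indicator_of_mem hxh, indicator_of_mem this]
          · rw [indicator_of_notMem hxh]; exact zero_le
      _ = ∫⁻ h in Metric.ball (0 : Rd d) (2 * r), ∫⁻ x in B,
            ENNReal.ofReal ((u (x + h) - u x) ^ 2) := by
          refine lintegral_lintegral_swap ?_
          refine Measurable.aemeasurable ?_
          simp only [Function.uncurry_def]
          fun_prop
      _ ≤ ∫⁻ h in Metric.ball (0 : Rd d) (2 * r),
            ENNReal.ofReal (4 * r ^ 2 * dirichletEnergy w) := by
          refine setLIntegral_mono' Metric.isOpen_ball.measurableSet fun h hh => ?_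
          have hd := (((w.toFun_L2loc.comp_add_right h).sub w.toFun_L2loc).ball z r).integrable_sq
          rw [← ofReal_integral_eq_lintegral_ofReal hd (Filter.Eventually.of_forall
            fun _ => sq_nonneg _)]
          refine ENNReal.ofReal_le_ofReal ((setIntegral_sq_diff_le w hw h z hr).trans ?_)
          refine mul_le_mul_of_nonneg_right ?_ (dirichletEnergy_nonneg w)
          have := mem_ball_zero_iff.1 hh
          nlinarith [norm_nonneg h]
      _ = ENNReal.ofReal (2 ^ d * m * (4 * r ^ 2 * dirichletEnergy w)) := by
          rw [setLIntegral_const, mul_comm, ENNReal.ofReal_mul (p := 2 ^ d * m) (by positivity)]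
          congr 1
          rw [← ENNReal.ofReal_toReal (measure_ball_lt_top (x := (0 : Rd d))).ne]
          congr 1
          have e1 := volume_real_ball (0 : Rd d) (r := 2 * r) (by positivity)
          have e2 := volume_real_ball z hr
          rw [Measure.real] at e1
          rw [e1, hmdef, hB, e2]
          ring
  rw [hJ] at hle
  have hfinal := (ENNReal.ofReal_le_ofReal_iff (mul_nonneg (by positivity)
    (mul_nonneg (by positivity) (dirichletEnergy_nonneg w)))).1 hle
  rw [hLHS]
  have e3 : I2 - I1 ^ 2 / m = (2 * m * I2 - 2 * I1 ^ 2) / (2 * m) := by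
    field_simp
  rw [e3, div_le_iff₀ (by positivity)]
  linarith

/-- A Poincaré inequality on the ball `B_r(z)`, with the gradient on the whole space on the
right-hand side. -/
theorem poincare_ball (w : H1loc d) (hw : ∀ k, MemLp (w.grad k) 2 volume)
    (z : Rd d) {r : ℝ} (hr : 0 < r) :
    ∫ x in Metric.ball z r, (w.toFun x - ballMean w z r) ^ 2
      ≤ 2 * 2 ^ d * r ^ 2 * dirichletEnergy w := by
  -- pass to a Borel measurable representative
  have hae := w.toFun_L2loc.aestronglyMeasurable
  have heq : w.toFun =ᵐ[volume] hae.mk := hae.ae_eq_mk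
  let v : H1loc d :=
    { toFun := hae.mk
      grad := w.grad
      toFun_L2loc := fun K hK => (w.toFun_L2loc K hK).ae_eq (ae_restrict_of_ae heq)
      grad_L2loc := w.grad_L2loc
      weak_grad := fun k η hη => by
        rw [← w.weak_grad k η hη]
        refine integral_congr_ae ?_
        filter_upwards [heq] with x hx
        rw [hx] }
  have hmean : ballMean w z r = ballMean v z r := by
    rw [ballMean_eq, ballMean_eq]
    congr 1
    exact integral_congr_ae (ae_restrict_of_ae heq)
  have := poincare_ball_of_measurable v hw hae.stronglyMeasurable_mk.measurable z hr
  refine le_trans (le_of_eq ?_) this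
  refine integral_congr_ae (ae_restrict_of_ae ?_)
  filter_upwards [heq] with x hx
  rw [hmean, hx]

/-! ### Testing a square integrable divergence-free field with functions of finite energy -/

/-- A cutoff has vanishing derivative wherever it attains its minimum `0`. -/
theorem pd_eq_zero_of_eq_zero {χ : Rd d → ℝ} (h0 : ∀ x, 0 ≤ χ x) {x : Rd d} (hx : χ x = 0)
    (k : Fin d) : pd k χ x = 0 := by
  have : IsLocalMin χ x := Filter.Eventually.of_forall fun y => hx ▸ h0 y
  simp [pd, this.fderiv_eq_zero]

/-- A cutoff has vanishing derivative wherever it attains its maximum `1`. -/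
theorem pd_eq_zero_of_eq_one {χ : Rd d → ℝ} (h1 : ∀ x, χ x ≤ 1) {x : Rd d} (hx : χ x = 1)
    (k : Fin d) : pd k χ x = 0 := by
  have : IsLocalMax χ x := Filter.Eventually.of_forall fun y => hx ▸ h1 y
  simp [pd, this.fderiv_eq_zero]

/-- The tails of a square integrable function over the complements of growing balls vanish. -/
theorem tendsto_setIntegral_compl_ball {f : Rd d → ℝ} (hf : MemLp f 2 volume) :
    Filter.Tendsto (fun n : ℕ => ∫ x, (Metric.ball (0 : Rd d) (n + 1))ᶜ.indicator f x ^ 2)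
      Filter.atTop (nhds 0) := by
  have h := tendsto_integral_of_dominated_convergence (μ := (volume : Measure (Rd d)))
    (F := fun (n : ℕ) x => (Metric.ball (0 : Rd d) (n + 1))ᶜ.indicator f x ^ 2)
    (f := fun _ => (0 : ℝ)) (fun x => f x ^ 2) ?_ hf.integrable_sq ?_ ?_
  · simpa using h
  · intro n
    exact (hf.aestronglyMeasurable.indicator Metric.isOpen_ball.measurableSet.compl).pow 2
  · refine fun n => Filter.Eventually.of_forall fun x => ?_
    by_cases hx : x ∈ (Metric.ball (0 : Rd d) (n + 1))ᶜ
    · rw [indicator_of_mem hx]; simp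
    · rw [indicator_of_notMem hx]; simp [sq_nonneg]
  · refine Filter.Eventually.of_forall fun x => ?_
    refine tendsto_const_nhds.congr' ?_
    obtain ⟨N, hN⟩ := exists_nat_gt ‖x‖
    filter_upwards [Filter.eventually_ge_atTop N] with n hn
    have : x ∈ Metric.ball (0 : Rd d) (n + 1) := by
      rw [mem_ball_zero_iff]
      have : (N : ℝ) ≤ n := by exact_mod_cast hn
      linarith
    simp only [mem_ball_zero_iff] at this
    simp [this]

/-- A square integrable, weakly divergence-free field is orthogonal to every square integrable
weak gradient. Testing with `χ (w - c)` for a cutoff `χ` between `B_r` and `B_{2r}`, the field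
`(w - c) ∇χ` is bounded in `L²` by the Poincaré inequality, and only sees the tail of the
divergence-free field outside of `B_r`. -/
theorem integral_divFree_mul_grad_eq_zero_of_memLp {F : Fin d → Rd d → ℝ}
    (hF : ∀ k, MemLp (F k) 2 volume)
    (hdiv : ∀ η : Rd d → ℝ, IsTest η → ∫ x, ∑ k, F k x * pd k η x = 0)
    (w : H1loc d) (hw : ∀ k, MemLp (w.grad k) 2 volume) :
    ∫ x, ∑ k, F k x * w.grad k x = 0 := by
  obtain ⟨M, -, hM⟩ := exists_cutoff d
  have hpos : ∀ n : ℕ, (0 : ℝ) < n + 1 := fun n => by positivity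
  choose χ hχ hχ0 hχ1 hχB hχB2 hχd using fun n : ℕ => hM 0 (n + 1) (hpos n)
  set c : ℕ → ℝ := fun n => ballMean w 0 (2 * (n + 1)) with hc
  set A : ℝ := M ^ 2 * (8 * 2 ^ d * dirichletEnergy w) with hA
  have hFg : Integrable (fun x => ∑ k, F k x * w.grad k x) volume :=
    integrable_finsetSum _ fun k _ => (hF k).integrable_mul (hw k)
  have hlim1 : Filter.Tendsto (fun n => ∫ x, χ n x * ∑ k, F k x * w.grad k x) Filter.atTop
      (nhds (∫ x, ∑ k, F k x * w.grad k x)) := by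
    refine tendsto_integral_of_dominated_convergence (fun x => |∑ k, F k x * w.grad k x|)
      (fun n => (hχ n).continuous.aestronglyMeasurable.mul hFg.aestronglyMeasurable) hFg.abs
      (fun n => Filter.Eventually.of_forall fun x => ?_)
      (Filter.Eventually.of_forall fun x => ?_)
    · rw [Real.norm_eq_abs, abs_mul, abs_of_nonneg (hχ0 n x)]
      exact mul_le_of_le_one_left (abs_nonneg _) (hχ1 n x)
    · refine tendsto_const_nhds.congr' ?_
      obtain ⟨N, hN⟩ := exists_nat_gt ‖x‖
      filter_upwards [Filter.eventually_ge_atTop N] with n hn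
      rw [hχB n x, one_mul]
      rw [mem_ball_zero_iff]
      have : (N : ℝ) ≤ n := by exact_mod_cast hn
      linarith
  have hmem : ∀ n k, MemLp (fun x => pd k (χ n) x * (w.toFun x - c n)) 2 volume := fun n k =>
    (w.toFun_L2loc.sub (continuous_const (y := c n)).l2loc).memLp_mul
      ((hχ n).pd k).continuous ((hχ n).pd k).2
  have hbound : ∀ n k, ∫ x, (pd k (χ n) x * (w.toFun x - c n)) ^ 2 ≤ A := by
    intro n k
    have h2 : (0 : ℝ) < 2 * (n + 1) := by positivity
    have hsq : IntegrableOn (fun x => (w.toFun x - c n) ^ 2) (Metric.ball 0 (2 * (n + 1))) :=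
      ((w.toFun_L2loc.sub (continuous_const (y := c n)).l2loc).ball 0 (2 * (n + 1))).integrable_sq
    calc ∫ x, (pd k (χ n) x * (w.toFun x - c n)) ^ 2
        ≤ ∫ x, (Metric.ball (0 : Rd d) (2 * (n + 1))).indicator
            (fun x => (M / (n + 1)) ^ 2 * (w.toFun x - c n) ^ 2) x := by
          refine integral_mono (hmem n k).integrable_sq
            ((integrable_indicator_iff Metric.isOpen_ball.measurableSet).2 (hsq.const_mul _)) fun x => ?_
          by_cases hx : x ∈ Metric.ball (0 : Rd d) (2 * (n + 1))
          · simp only [indicator_of_mem hx, mul_pow]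
            refine mul_le_mul_of_nonneg_right ?_ (sq_nonneg _)
            rw [← sq_abs]
            exact pow_le_pow_left₀ (abs_nonneg _) (hχd n k x) 2
          · simp only [indicator_of_notMem hx]
            rw [pd_eq_zero_of_eq_zero (hχ0 n) (hχB2 n x hx) k]
            simp
      _ = (M / (n + 1)) ^ 2 * ∫ x in Metric.ball 0 (2 * (n + 1)), (w.toFun x - c n) ^ 2 := by
          rw [integral_indicator Metric.isOpen_ball.measurableSet, integral_const_mul]
      _ ≤ (M / (n + 1)) ^ 2 * (2 * 2 ^ d * (2 * (n + 1)) ^ 2 * dirichletEnergy w) :=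
          mul_le_mul_of_nonneg_left (poincare_ball w hw 0 h2) (sq_nonneg _)
      _ = A := by
          have := (hpos n).ne'
          rw [hA]; field_simp; ring
  have hle : ∀ n, |∫ x, χ n x * ∑ k, F k x * w.grad k x| ≤ ∑ k, √((∫ x,
      (Metric.ball (0 : Rd d) (n + 1))ᶜ.indicator (F k) x ^ 2) * A) := by
    intro n
    have h1 := integral_divFree_mul_cutoff_eq_zero (fun k => (hF k).l2loc) hdiv w (c n) (hχ n)
    have hind : ∀ k, MemLp ((Metric.ball (0 : Rd d) (n + 1))ᶜ.indicator (F k)) 2 volume :=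
      fun k => (hF k).indicator Metric.isOpen_ball.measurableSet.compl
    have i1 : Integrable (fun x => χ n x * ∑ k, F k x * w.grad k x) :=
      hFg.bdd_mul (c := 1) (hχ n).continuous.aestronglyMeasurable
        (Filter.Eventually.of_forall fun x => by
          rw [Real.norm_eq_abs, abs_of_nonneg (hχ0 n x)]; exact hχ1 n x)
    have i2 : ∀ k, Integrable (fun x => (Metric.ball (0 : Rd d) (n + 1))ᶜ.indicator (F k) x *
        (pd k (χ n) x * (w.toFun x - c n))) := fun k => (hind k).integrable_mul (hmem n k)
    have h2 : ∀ x, ∑ k, F k x * (χ n x * w.grad k x + pd k (χ n) x * (w.toFun x - c n))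
        = χ n x * ∑ k, F k x * w.grad k x
          + ∑ k, (Metric.ball (0 : Rd d) (n + 1))ᶜ.indicator (F k) x *
            (pd k (χ n) x * (w.toFun x - c n)) := by
      intro x
      rw [Finset.mul_sum, ← Finset.sum_add_distrib]
      refine Finset.sum_congr rfl fun k _ => ?_
      by_cases hx : x ∈ (Metric.ball (0 : Rd d) (n + 1))ᶜ
      · rw [indicator_of_mem hx]; ring
      · rw [indicator_of_notMem hx, pd_eq_zero_of_eq_one (hχ1 n) (hχB n x (not_not.1 hx))]; ring
    simp_rw [h2] at h1
    rw [integral_add i1 (integrable_finsetSum _ fun k _ => i2 k)] at h1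
    rw [eq_neg_of_add_eq_zero_left h1, abs_neg, integral_finsetSum _ fun k _ => i2 k]
    refine (Finset.abs_sum_le_sum_abs _ _).trans (Finset.sum_le_sum fun k _ => ?_)
    refine Real.abs_le_sqrt ((sq_integral_mul_le (hind k) (hmem n k)).trans ?_)
    exact mul_le_mul_of_nonneg_left (hbound n k) (integral_nonneg fun _ => sq_nonneg _)
  have hlim2 : Filter.Tendsto (fun n : ℕ => ∑ k, √((∫ x,
      (Metric.ball (0 : Rd d) (n + 1))ᶜ.indicator (F k) x ^ 2) * A)) Filter.atTop (nhds 0) := by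
    have : ∀ k, Filter.Tendsto (fun n : ℕ => √((∫ x,
        (Metric.ball (0 : Rd d) (n + 1))ᶜ.indicator (F k) x ^ 2) * A)) Filter.atTop (nhds 0) := by
      intro k
      have := ((tendsto_setIntegral_compl_ball (hF k)).mul_const A).sqrt
      simpa using this
    simpa using tendsto_finsetSum Finset.univ fun k _ => this k
  exact tendsto_nhds_unique hlim1 (squeeze_zero_norm hle hlim2)

/-! ### Elliptic coefficient fields and the corrector equation -/

theorem IsCoefficientField.diag_le {lam : ℝ} {a : Rd d → Matrix (Fin d) (Fin d) ℝ}
    (ha : IsCoefficientField lam a) (x : Rd d) (i : Fin d) : a x i i ≤ 1 := by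
  have h := ha.upper x (Pi.single i 1)
  simpa [Pi.single_apply] using h

/-- The entries of a coefficient field are bounded by `1`. -/
theorem IsCoefficientField.abs_le_one {lam : ℝ} (hlam : 0 < lam)
    {a : Rd d → Matrix (Fin d) (Fin d) ℝ}
    (ha : IsCoefficientField lam a) (x : Rd d) (i j : Fin d) : |a x i j| ≤ 1 := by
  have hsym : a x j i = a x i j := (ha.symm x).apply i j
  have hi := ha.diag_le x i
  have hj := ha.diag_le x j
  -- test with `e_i + t e_j` for `t = ±1`
  have key : ∀ t : ℝ, 0 ≤ a x i i + 2 * t * a x i j + t ^ 2 * a x j j := by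
    intro t
    have h := ha.lower x (Pi.single i 1 + t • Pi.single j 1)
    have h0 : 0 ≤ lam * ∑ k, (Pi.single i 1 + t • Pi.single j 1 : Fin d → ℝ) k ^ 2 :=
      mul_nonneg hlam.le (Finset.sum_nonneg fun _ _ => sq_nonneg _)
    have h2 := h0.trans h
    simp only [Pi.add_apply, Pi.smul_apply, smul_eq_mul, Pi.single_apply, mul_ite, mul_one,
      mul_zero, add_mul, mul_add, ite_mul, one_mul, zero_mul, Finset.sum_add_distrib,
      Finset.sum_ite_eq', Finset.mem_univ, if_true] at h2
    rw [hsym] at h2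
    nlinarith
  have h1 := key 1
  have h2 := key (-1)
  rw [abs_le]
  constructor <;> nlinarith

open scoped Classical in
theorem IsCoefficientField.defectMedium {lam : ℝ} {a a₀ : Rd d → Matrix (Fin d) (Fin d) ℝ}
    (ha : IsCoefficientField lam a) (ha₀ : IsCoefficientField lam a₀) (y : Rd d) (R : ℝ) :
    IsCoefficientField lam (defectMedium a a₀ y R) where
  measurable i j := by
    have : (fun x => _root_.defectMedium a a₀ y R x i j)
        = (Metric.ball y R).piecewise (fun x => a₀ x i j) (fun x => a x i j) := by
      ext x
      by_cases hx : x ∈ Metric.ball y R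
      · rw [piecewise_eq_of_mem _ _ _ hx, _root_.defectMedium, if_pos hx]
      · rw [piecewise_eq_of_notMem _ _ _ hx, _root_.defectMedium, if_neg hx]
    rw [this]
    exact (ha₀.measurable i j).piecewise Metric.isOpen_ball.measurableSet (ha.measurable i j)
  symm x := by
    unfold _root_.defectMedium
    split_ifs
    exacts [ha₀.symm x, ha.symm x]
  upper x := by
    unfold _root_.defectMedium
    split_ifs
    exacts [ha₀.upper x, ha.upper x]
  lower x := by
    unfold _root_.defectMedium
    split_ifs
    exacts [ha₀.lower x, ha.lower x]

/-- The `l`-th component of `e_i + ∇φ_i`, the gradient of the `a`-harmonic coordinate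
`x_i + φ_i`. -/
noncomputable def harmonicGrad (φ : Fin d → H1loc d) (i l : Fin d) (x : Rd d) : ℝ :=
  (if l = i then 1 else 0) + (φ i).grad l x

theorem flux_eq_sum (a : Rd d → Matrix (Fin d) (Fin d) ℝ) (φ : Fin d → H1loc d) (i j : Fin d)
    (x : Rd d) : flux a φ i j x = ∑ l, a x j l * harmonicGrad φ i l x := rfl

theorem l2loc_harmonicGrad (φ : Fin d → H1loc d) (i l : Fin d) :
    L2loc (harmonicGrad φ i l) :=
  (continuous_const.l2loc).add ((φ i).grad_L2loc l)

theorem IsCoefficientField.l2loc_flux {lam : ℝ} (hlam : 0 < lam)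
    {a : Rd d → Matrix (Fin d) (Fin d) ℝ} (ha : IsCoefficientField lam a)
    (φ : Fin d → H1loc d) (i j : Fin d) : L2loc (flux a φ i j) :=
  L2loc.sum Finset.univ fun l => (l2loc_harmonicGrad φ i l).bdd_mul
    (ha.measurable j l).aestronglyMeasurable 1 fun x => ha.abs_le_one hlam x j l

theorem pd_comm {η : Rd d → ℝ} (hη : ContDiff ℝ ∞ η) (j k : Fin d) (x : Rd d) :
    pd j (pd k η) x = pd k (pd j η) x := by
  have hs : IsSymmSndFDerivAt ℝ η x := hη.contDiffAt.isSymmSndFDerivAt (by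
    simpa using (WithTop.coe_le_coe.2 (le_top : (2 : ℕ∞) ≤ ⊤)))
  have hd : DifferentiableAt ℝ (fderiv ℝ η) x :=
    ((hη.fderiv_right (m := ∞) (by simp)).differentiable (by simp)) x
  have e : ∀ j k, pd j (pd k η) x = fderiv ℝ (fderiv ℝ η) x (EuclideanSpace.single j 1)
      (EuclideanSpace.single k 1) := by
    intro j k
    have h1 : HasFDerivAt (fun x => fderiv ℝ η x (EuclideanSpace.single k 1))
        (((fderiv ℝ (fderiv ℝ η) x)).flip (EuclideanSpace.single k 1)) x := by
      simpa using hd.hasFDerivAt.clm_apply (hasFDerivAt_const _ _)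
    change fderiv ℝ (fun x => fderiv ℝ η x (EuclideanSpace.single k 1)) x _ = _
    rw [h1.fderiv]
    rfl
  rw [e, e]
  exact hs _ _

/-- The flux of an augmented corrector is divergence free, since the divergence of a
skew-symmetric tensor field is. -/
theorem IsAugmentedCorrector.solvesCorrectorEq {a : Rd d → Matrix (Fin d) (Fin d) ℝ}
    {ah : Matrix (Fin d) (Fin d) ℝ} {φ : Fin d → H1loc d} {σ : Fin d → Fin d → Fin d → H1loc d}
    (h : IsAugmentedCorrector a ah φ σ) : SolvesCorrectorEq a φ := by
  intro i η hη
  have hae : ∀ᵐ x, ∀ j, flux a φ i j x = ah j i + ∑ k, (σ i j k).grad k x :=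
    ae_all_iff.2 fun j => h.flux_eq i j
  have e1 : ∫ x, ∑ j, flux a φ i j x * pd j η x
      = ∫ x, ∑ j, (ah j i * pd j η x + ∑ k, (σ i j k).grad k x * pd j η x) := by
    refine integral_congr_ae ?_
    filter_upwards [hae] with x hx
    refine Finset.sum_congr rfl fun j _ => ?_
    rw [hx j, add_mul, Finset.sum_mul]
  have i1 : ∀ j k, Integrable fun x => (σ i j k).grad k x * pd j η x := fun j k =>
    ((σ i j k).grad_L2loc k).integrable_mul (hη.pd j).continuous (hη.pd j).2
  have i2 : ∀ j, Integrable fun x => ah j i * pd j η x := fun j =>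
    (hη.pd j).integrable.const_mul _
  have i3 : ∀ j, Integrable fun x => ∑ k, (σ i j k).grad k x * pd j η x := fun j =>
    integrable_finsetSum _ fun k _ => i1 j k
  have e2 : ∀ j, ∫ x, (ah j i * pd j η x + ∑ k, (σ i j k).grad k x * pd j η x)
      = - ∑ k, ∫ x, (σ i j k).toFun x * pd k (pd j η) x := by
    intro j
    rw [integral_add (i2 j) (i3 j), integral_const_mul, integral_pd_eq_zero hη,
      integral_finsetSum _ fun k _ => i1 j k, mul_zero, zero_add, ← Finset.sum_neg_distrib]
    refine Finset.sum_congr rfl fun k _ => ?_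
    rw [(σ i j k).weak_grad k _ (hη.pd j), neg_neg]
  have i4 : ∀ j, Integrable fun x => ah j i * pd j η x + ∑ k, (σ i j k).grad k x * pd j η x :=
    fun j => (i2 j).add (i3 j)
  rw [e1, integral_finsetSum _ fun j _ => i4 j]
  simp_rw [e2]
  rw [Finset.sum_neg_distrib, neg_eq_zero]
  set S := ∑ j, ∑ k, ∫ x, (σ i j k).toFun x * pd k (pd j η) x with hS
  have hskew : S = -S := by
    conv_lhs => rw [hS, Finset.sum_comm]
    rw [hS, ← Finset.sum_neg_distrib]
    refine Finset.sum_congr rfl fun j _ => ?_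
    rw [← Finset.sum_neg_distrib]
    refine Finset.sum_congr rfl fun k _ => ?_
    rw [← integral_neg]
    refine integral_congr_ae ?_
    filter_upwards [h.skew i k j] with x hx
    rw [hx, pd_comm hη.1]
    ring
  linarith

/-- Caccioppoli's inequality for the harmonic coordinate `x_i + φ_i`, with a constant depending
only on the dimension and the ellipticity ratio. -/
theorem exists_caccioppoli (d : ℕ) {lam : ℝ} (hlam : 0 < lam) : ∃ C : ℝ, 0 < C ∧
    ∀ (a : Rd d → Matrix (Fin d) (Fin d) ℝ) (φ : Fin d → H1loc d), IsCoefficientField lam a →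
      SolvesCorrectorEq a φ → ∀ (i : Fin d) (z : Rd d) (s : ℝ), 0 < s → ∀ c : ℝ,
      ∫ x in Metric.ball z s, ∑ l, harmonicGrad φ i l x ^ 2
        ≤ C / s ^ 2 * ∫ x in Metric.ball z (2 * s), (x i + (φ i).toFun x - c) ^ 2 := by
  obtain ⟨M, hM0, hM⟩ := exists_cutoff d
  refine ⟨4 * d ^ 3 * M ^ 2 / lam ^ 2 + 1, by positivity, fun a φ ha hφ i z s hs c => ?_⟩
  obtain ⟨χ, hχ, hχ0, hχ1, hχB, hχB2, hχd⟩ := hM z s hs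
  set q := flux a φ i with hq
  set p := harmonicGrad φ i with hp
  set u : Rd d → ℝ := fun x => x i + (φ i).toFun x - c with hu
  have hqL : ∀ k, L2loc (q k) := fun k => ha.l2loc_flux hlam φ i k
  have hpL : ∀ l, L2loc (p l) := fun l => l2loc_harmonicGrad φ i l
  have hxc : ContDiff ℝ ∞ fun x : Rd d => x i := (EuclideanSpace.proj i :
    Rd d →L[ℝ] ℝ).contDiff
  have huL : L2loc u := ((hxc.continuous.l2loc).add (φ i).toFun_L2loc).sub
    (continuous_const (y := c)).l2loc
  have hχ2 : IsTest fun x => χ x * χ x := hχ.mul_contDiff hχ.1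
  have hpχ2 : ∀ k x, pd k (fun x => χ x * χ x) x = 2 * χ x * pd k χ x := fun k x => by
    rw [pd_mul k (hχ.differentiable x) (hχ.differentiable x)]; ring
  have hpx : ∀ k x, pd k (fun x : Rd d => x i) x = if k = i then 1 else 0 := fun k x => by
    have : HasFDerivAt (fun x : Rd d => x i) (EuclideanSpace.proj i : Rd d →L[ℝ] ℝ) x :=
      (EuclideanSpace.proj i : Rd d →L[ℝ] ℝ).hasFDerivAt
    simp [pd, this.fderiv, eq_comm]
  have hpd0 : ∀ k x, x ∉ Metric.ball z (2 * s) → pd k χ x = 0 := fun k x hx =>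
    pd_eq_zero_of_eq_zero hχ0 (hχB2 x hx) k
  -- the integrand obtained by testing the equation with `χ² u`
  set T : Rd d → ℝ := fun x => ∑ k, q k x * (χ x * χ x * p k x + 2 * χ x * pd k χ x * u x)
    with hT
  have hT0 : ∫ x, T x = 0 := by
    have h1 := integral_divFree_mul_cutoff_eq_zero hqL (hφ i) (φ i) c hχ2
    have h2 := hφ i _ (hχ2.mul_contDiff hxc)
    have i1 : Integrable (fun x => ∑ k, q k x * pd k (fun x => χ x * χ x * x i) x) :=
      integrable_finsetSum _ fun k _ => (hqL k).integrable_mul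
        ((hχ2.mul_contDiff hxc).pd k).continuous ((hχ2.mul_contDiff hxc).pd k).2
    have i2 : Integrable (fun x => ∑ k, q k x * (χ x * χ x * (φ i).grad k x
        + pd k (fun x => χ x * χ x) x * ((φ i).toFun x - c))) := by
      refine integrable_finsetSum _ fun k _ => (hqL k).integrable_mul_of_support ?_ hχ2.2
        fun x hx => ?_
      · exact (((φ i).grad_L2loc k).mul_continuous hχ2.continuous).add
          (((φ i).toFun_L2loc.sub (continuous_const (y := c)).l2loc).mul_continuous
            (hχ2.pd k).continuous)
      · have : χ x * χ x = 0 :=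
          image_eq_zero_of_notMem_tsupport (f := fun x => χ x * χ x) hx
        rw [this, pd_eq_zero_of_notMem_tsupport k hx]
        ring
    have h3 : ∀ x, T x = ∑ k, q k x * pd k (fun x => χ x * χ x * x i) x
        + ∑ k, q k x * (χ x * χ x * (φ i).grad k x
        + pd k (fun x => χ x * χ x) x * ((φ i).toFun x - c)) := by
      intro x
      rw [hT, ← Finset.sum_add_distrib]
      refine Finset.sum_congr rfl fun k _ => ?_
      rw [pd_mul k (hχ2.differentiable x) (hxc.differentiable (by simp) x), hpχ2, hpx, hp, hu]
      simp only [harmonicGrad]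
      ring
    simp_rw [h3]
    rw [integral_add i1 i2, h2, h1, add_zero]
  have hTi : Integrable T := by
    refine integrable_finsetSum _ fun k _ => (hqL k).integrable_mul_of_support ?_ hχ.2
      fun x hx => ?_
    · refine ((hpL k).mul_continuous hχ2.continuous).add (huL.mul_continuous ?_)
      exact (continuous_const.mul hχ.continuous).mul (hχ.pd k).continuous
    · rw [image_eq_zero_of_notMem_tsupport hx]; ring
  set K : ℝ := 2 * d / lam * (d * (M / s)) ^ 2 with hK
  have hP : Integrable (fun x => ∑ l, (χ x * p l x) ^ 2) := integrable_finsetSum _ fun l _ =>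
    ((hpL l).memLp_mul hχ.continuous hχ.2).integrable_sq
  have hU : Integrable ((Metric.ball z (2 * s)).indicator fun x => u x ^ 2) :=
    (integrable_indicator_iff Metric.isOpen_ball.measurableSet).2
      (huL.ball z (2 * s)).integrable_sq
  have hpoint : ∀ x, lam / 2 * ∑ l, (χ x * p l x) ^ 2
      - K * (Metric.ball z (2 * s)).indicator (fun x => u x ^ 2) x ≤ T x := by
    intro x
    by_cases hx : x ∈ Metric.ball z (2 * s)
    · rw [indicator_of_mem hx]
      set t := d * (M / s) with ht
      have ht0 : 0 ≤ t := by positivity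
      have hell : lam * ∑ l, p l x ^ 2 ≤ ∑ k, q k x * p k x := by
        refine (ha.lower x fun l => p l x).trans_eq (Finset.sum_congr rfl fun k _ => ?_)
        rw [hq, flux_eq_sum, Finset.sum_mul]
        exact Finset.sum_congr rfl fun l _ => by ring
      have hcross : |∑ k, q k x * pd k χ x| ≤ t * ∑ l, |p l x| := by
        have hqk : ∀ k, |q k x| ≤ ∑ l, |p l x| := fun k => by
          rw [hq, flux_eq_sum]
          refine (Finset.abs_sum_le_sum_abs _ _).trans (Finset.sum_le_sum fun l _ => ?_)
          rw [abs_mul]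
          exact mul_le_of_le_one_left (abs_nonneg _) (ha.abs_le_one hlam x k l)
        calc |∑ k, q k x * pd k χ x| ≤ ∑ k, |q k x * pd k χ x| :=
              Finset.abs_sum_le_sum_abs _ _
          _ ≤ ∑ _k : Fin d, (∑ l, |p l x|) * (M / s) := by
              refine Finset.sum_le_sum fun k _ => ?_
              rw [abs_mul]
              exact mul_le_mul (hqk k) (hχd k x) (abs_nonneg _)
                (Finset.sum_nonneg fun _ _ => abs_nonneg _)
          _ = t * ∑ l, |p l x| := by
              rw [Finset.sum_const, Finset.card_univ, Fintype.card_fin, nsmul_eq_mul, ht]; ring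
      have hTx : T x = χ x ^ 2 * ∑ k, q k x * p k x
          + 2 * χ x * u x * ∑ k, q k x * pd k χ x := by
        rw [hT, Finset.mul_sum, Finset.mul_sum, ← Finset.sum_add_distrib]
        exact Finset.sum_congr rfl fun k _ => by ring
      have hlow : - (2 * χ x * |u x| * (t * ∑ l, |p l x|))
          ≤ 2 * χ x * u x * ∑ k, q k x * pd k χ x := by
        refine (abs_le.1 ?_).1
        rw [abs_mul, abs_mul, abs_mul, abs_two, abs_of_nonneg (hχ0 x)]
        exact mul_le_mul_of_nonneg_left hcross
          (mul_nonneg (mul_nonneg zero_le_two (hχ0 x)) (abs_nonneg _))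
      have hyoung : 2 * χ x * |u x| * (t * ∑ l, |p l x|)
          ≤ lam / 2 * ∑ l, (χ x * p l x) ^ 2 + K * u x ^ 2 := by
        have h1 : ∀ l, 2 * χ x * |u x| * (t * |p l x|)
            ≤ lam / 2 * (χ x * p l x) ^ 2 + 2 / lam * t ^ 2 * u x ^ 2 := by
          intro l
          -- Young's inequality as a completed square
          have h2 : 0 ≤ (lam / 2) * (χ x * |p l x| - 2 / lam * (t * |u x|)) ^ 2 := by positivity
          have h3 : (lam / 2) * (χ x * |p l x| - 2 / lam * (t * |u x|)) ^ 2
              = lam / 2 * (χ x ^ 2 * |p l x| ^ 2) + 2 / lam * t ^ 2 * |u x| ^ 2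
                - 2 * χ x * |u x| * (t * |p l x|) := by
            field_simp; ring
          rw [sq_abs, sq_abs] at h3
          rw [mul_pow]
          linarith
        calc 2 * χ x * |u x| * (t * ∑ l, |p l x|)
            = ∑ l, 2 * χ x * |u x| * (t * |p l x|) := by rw [Finset.mul_sum, Finset.mul_sum]
          _ ≤ ∑ l, (lam / 2 * (χ x * p l x) ^ 2 + 2 / lam * t ^ 2 * u x ^ 2) :=
              Finset.sum_le_sum fun l _ => h1 l
          _ = _ := by
              rw [Finset.sum_add_distrib, ← Finset.mul_sum, Finset.sum_const, Finset.card_univ,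
                Fintype.card_fin, nsmul_eq_mul, hK]
              ring
      have hmain : lam * ∑ l, (χ x * p l x) ^ 2 ≤ χ x ^ 2 * ∑ k, q k x * p k x := by
        have : ∑ l, (χ x * p l x) ^ 2 = χ x ^ 2 * ∑ l, p l x ^ 2 := by
          rw [Finset.mul_sum]; exact Finset.sum_congr rfl fun l _ => mul_pow _ _ _
        rw [this]
        have := mul_le_mul_of_nonneg_left hell (sq_nonneg (χ x))
        linarith
      rw [hTx]
      linarith
    · rw [indicator_of_notMem hx]
      simp [hT, hχB2 x hx]
  have hint : lam / 2 * (∫ x, ∑ l, (χ x * p l x) ^ 2)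
      - K * ∫ x in Metric.ball z (2 * s), u x ^ 2 ≤ 0 := by
    rw [← hT0, ← integral_indicator Metric.isOpen_ball.measurableSet, ← integral_const_mul,
      ← integral_const_mul, ← integral_sub (hP.const_mul _) (hU.const_mul _)]
    exact integral_mono ((hP.const_mul _).sub (hU.const_mul _)) hTi hpoint
  have hball : ∫ x in Metric.ball z s, ∑ l, p l x ^ 2 ≤ ∫ x, ∑ l, (χ x * p l x) ^ 2 := by
    calc ∫ x in Metric.ball z s, ∑ l, p l x ^ 2
        = ∫ x in Metric.ball z s, ∑ l, (χ x * p l x) ^ 2 :=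
          setIntegral_congr_fun Metric.isOpen_ball.measurableSet fun x hx => by
            simp [hχB x hx]
      _ ≤ _ := setIntegral_le_integral hP (Filter.Eventually.of_forall fun x =>
          Finset.sum_nonneg fun _ _ => sq_nonneg _)
  have hU0 : 0 ≤ ∫ x in Metric.ball z (2 * s), u x ^ 2 := integral_nonneg fun _ => sq_nonneg _
  have hKe : 2 / lam * K = 4 * d ^ 3 * M ^ 2 / lam ^ 2 / s ^ 2 := by
    rw [hK]; field_simp; ring
  have h5 : ∫ x, ∑ l, (χ x * p l x) ^ 2 ≤ 2 / lam * K * ∫ x in Metric.ball z (2 * s), u x ^ 2 := by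
    have : 2 / lam * (lam / 2 * ∫ x, ∑ l, (χ x * p l x) ^ 2)
        ≤ 2 / lam * (K * ∫ x in Metric.ball z (2 * s), u x ^ 2) :=
      mul_le_mul_of_nonneg_left (by linarith) (by positivity)
    rw [← mul_assoc, div_mul_div_cancel₀ hlam.ne', div_self two_ne_zero, one_mul] at this
    rwa [mul_assoc]
  refine (hball.trans h5).trans (mul_le_mul_of_nonneg_right ?_ hU0)
  rw [hKe]
  gcongr
  linarith

/-! ### Energy estimates for the perturbation of the augmented corrector -/

theorem MeasureTheory.MemLp.bdd_mul_of_abs_le {f m : Rd d → ℝ} (hf : MemLp f 2 volume)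
    (hm : AEStronglyMeasurable m volume) (C : ℝ) (hC : ∀ x, |m x| ≤ C) :
    MemLp (fun x => m x * f x) 2 volume :=
  hf.of_le_mul (hm.mul hf.aestronglyMeasurable) (c := C) (Filter.Eventually.of_forall fun x => by
    rw [norm_mul]; exact mul_le_mul_of_nonneg_right (hC x) (norm_nonneg _))

theorem dirichletEnergy_eq_integral (w : H1loc d) (hw : ∀ k, MemLp (w.grad k) 2 volume) :
    dirichletEnergy w = ∫ x, ∑ k, w.grad k x ^ 2 := by
  rw [integral_finsetSum _ fun k _ => (hw k).integrable_sq, dirichletEnergy]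

theorem defectMedium_of_notMem {a a₀ : Rd d → Matrix (Fin d) (Fin d) ℝ} {y : Rd d} {R : ℝ}
    {x : Rd d} (hx : x ∉ Metric.ball y R) : defectMedium a a₀ y R x = a x := if_neg hx

section Corrector

variable {lam : ℝ} {a a₀ : Rd d → Matrix (Fin d) (Fin d) ℝ} {y : Rd d} {R : ℝ}
  {φ φ' : Fin d → H1loc d}

/-- `q'_i - q_i = a' ∇(φ'_i - φ_i) + (a' - a)(e_i + ∇φ_i)`, where the last term is supported in
`B_R(y)`. -/
theorem flux_sub_flux (a a₀ : Rd d → Matrix (Fin d) (Fin d) ℝ) (y : Rd d) (R : ℝ)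
    (φ φ' : Fin d → H1loc d) (i k : Fin d) (x : Rd d) :
    flux (defectMedium a a₀ y R) φ' i k x - flux a φ i k x
      = ∑ l, (defectMedium a a₀ y R x k l * ((φ' i).sub (φ i)).grad l x
        + (defectMedium a a₀ y R x k l - a x k l)
          * (Metric.ball y R).indicator (harmonicGrad φ i l) x) := by
  rw [flux_eq_sum, flux_eq_sum, ← Finset.sum_sub_distrib]
  refine Finset.sum_congr rfl fun l _ => ?_
  simp only [H1loc.sub]
  by_cases hx : x ∈ Metric.ball y R
  · rw [indicator_of_mem hx]; simp only [harmonicGrad]; ring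
  · rw [indicator_of_notMem hx, defectMedium_of_notMem hx]; simp only [harmonicGrad]; ring

theorem memLp_indicator_harmonicGrad (φ : Fin d → H1loc d) (i l : Fin d) (y : Rd d) (R : ℝ) :
    MemLp ((Metric.ball y R).indicator (harmonicGrad φ i l)) 2 volume :=
  (memLp_indicator_iff_restrict Metric.isOpen_ball.measurableSet).2
    ((l2loc_harmonicGrad φ i l).ball y R)

theorem integral_sum_indicator_sq (φ : Fin d → H1loc d) (i : Fin d) (y : Rd d) (R : ℝ) :
    ∫ x, ∑ l, (Metric.ball y R).indicator (harmonicGrad φ i l) x ^ 2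
      = ∫ x in Metric.ball y R, ∑ l, harmonicGrad φ i l x ^ 2 := by
  rw [← integral_indicator Metric.isOpen_ball.measurableSet]
  congr 1; ext x
  by_cases hx : x ∈ Metric.ball y R
  · simp only [indicator_of_mem hx]
  · simp [indicator_of_notMem hx]

theorem abs_defectMedium_sub_le (hlam : 0 < lam) (ha : IsCoefficientField lam a)
    (ha₀ : IsCoefficientField lam a₀) (x : Rd d) (k l : Fin d) :
    |defectMedium a a₀ y R x k l - a x k l| ≤ 2 := by
  have h1 := (ha.defectMedium ha₀ y R).abs_le_one hlam x k l
  have h2 := ha.abs_le_one hlam x k l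
  exact (abs_sub _ _).trans (by linarith)

theorem memLp_flux_sub_flux (hlam : 0 < lam) (ha : IsCoefficientField lam a)
    (ha₀ : IsCoefficientField lam a₀) {i : Fin d} (hi : SameAtInfinity (φ' i) (φ i))
    (k : Fin d) :
    MemLp (fun x => flux (defectMedium a a₀ y R) φ' i k x - flux a φ i k x) 2 volume := by
  simp_rw [flux_sub_flux]
  have ha' := ha.defectMedium ha₀ y R
  refine memLp_finsetSum _ fun l _ => ?_
  refine MemLp.add ?_ ?_
  · exact MemLp.bdd_mul_of_abs_le (hi l) (ha'.measurable k l).aestronglyMeasurable 1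
      fun x => ha'.abs_le_one hlam x k l
  · exact (memLp_indicator_harmonicGrad φ i l y R).bdd_mul_of_abs_le
      ((ha'.measurable k l).sub (ha.measurable k l)).aestronglyMeasurable 2
      fun x => abs_defectMedium_sub_le hlam ha ha₀ x k l

/-- The energy of `φ'_i - φ_i` is controlled by the energy of `x_i + φ_i` in the defect. -/
theorem dirichletEnergy_corrector_le (hlam : 0 < lam) (ha : IsCoefficientField lam a)
    (ha₀ : IsCoefficientField lam a₀) (hφ : SolvesCorrectorEq a φ)
    (hφ' : SolvesCorrectorEq (defectMedium a a₀ y R) φ') {i : Fin d}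
    (hi : SameAtInfinity (φ' i) (φ i)) :
    dirichletEnergy ((φ' i).sub (φ i))
      ≤ 4 * d ^ 2 / lam ^ 2 * ∫ x in Metric.ball y R, ∑ l, harmonicGrad φ i l x ^ 2 := by
  have ha' := ha.defectMedium ha₀ y R
  set a' := defectMedium a a₀ y R with ha'def
  set w := (φ' i).sub (φ i) with hw
  set p : Fin d → Rd d → ℝ := fun l => (Metric.ball y R).indicator (harmonicGrad φ i l) with hp
  have hgw : ∀ k, MemLp (w.grad k) 2 volume := hi
  have hF : ∀ k, MemLp (fun x => flux a' φ' i k x - flux a φ i k x) 2 volume := fun k =>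
    memLp_flux_sub_flux hlam ha ha₀ hi k
  have hd : (0 : ℝ) < d := by exact_mod_cast i.pos
  have horth := integral_divFree_mul_grad_eq_zero_of_memLp hF (fun η hη => by
    have i1 : Integrable (fun x => ∑ k, flux a' φ' i k x * pd k η x) :=
      integrable_finsetSum _ fun k _ => (ha'.l2loc_flux hlam φ' i k).integrable_mul
        (hη.pd k).continuous (hη.pd k).2
    have i2 : Integrable (fun x => ∑ k, flux a φ i k x * pd k η x) :=
      integrable_finsetSum _ fun k _ => (ha.l2loc_flux hlam φ i k).integrable_mul
        (hη.pd k).continuous (hη.pd k).2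
    have e : ∀ x, ∑ k, (flux a' φ' i k x - flux a φ i k x) * pd k η x
        = ∑ k, flux a' φ' i k x * pd k η x - ∑ k, flux a φ i k x * pd k η x := fun x => by
      rw [← Finset.sum_sub_distrib]
      exact Finset.sum_congr rfl fun k _ => sub_mul _ _ _
    simp_rw [e]
    rw [integral_sub i1 i2, hφ' i η hη, hφ i η hη, sub_zero]) w hgw
  have hpoint : ∀ x, lam / 2 * ∑ k, w.grad k x ^ 2 - 2 * d ^ 2 / lam * ∑ l, p l x ^ 2
      ≤ ∑ k, (flux a' φ' i k x - flux a φ i k x) * w.grad k x := by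
    intro x
    have hsplit : ∑ k, (flux a' φ' i k x - flux a φ i k x) * w.grad k x
        = ∑ k, ∑ l, w.grad k x * a' x k l * w.grad l x
          + ∑ k, ∑ l, (a' x k l - a x k l) * p l x * w.grad k x := by
      rw [← Finset.sum_add_distrib]
      refine Finset.sum_congr rfl fun k _ => ?_
      rw [ha'def, flux_sub_flux, Finset.sum_mul, ← Finset.sum_add_distrib]
      exact Finset.sum_congr rfl fun l _ => by simp only [hp, hw]; ring
    have hell := ha'.lower x fun k => w.grad k x
    have hcross : ∀ k l, -(lam / (2 * d) * w.grad k x ^ 2 + 2 * d / lam * p l x ^ 2)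
        ≤ (a' x k l - a x k l) * p l x * w.grad k x := by
      intro k l
      have h1 : |(a' x k l - a x k l) * p l x * w.grad k x|
          ≤ 2 * |p l x| * |w.grad k x| := by
        rw [abs_mul, abs_mul]
        gcongr
        exact abs_defectMedium_sub_le hlam ha ha₀ x k l
      -- Young's inequality as a completed square; summed over `k` and `l`, the gradient term
      -- takes half of the ellipticity bound
      have h2 : 0 ≤ lam / (2 * d) * (|w.grad k x| - 2 * d / lam * |p l x|) ^ 2 := by positivity
      have h3 : lam / (2 * d) * (|w.grad k x| - 2 * d / lam * |p l x|) ^ 2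
          = lam / (2 * d) * |w.grad k x| ^ 2 + 2 * d / lam * |p l x| ^ 2
            - 2 * |p l x| * |w.grad k x| := by
        field_simp; ring
      rw [sq_abs, sq_abs] at h3
      have := (abs_le.1 h1).1
      linarith
    have hsum : -(lam / 2 * ∑ k, w.grad k x ^ 2 + 2 * d ^ 2 / lam * ∑ l, p l x ^ 2)
        ≤ ∑ k, ∑ l, (a' x k l - a x k l) * p l x * w.grad k x := by
      refine le_trans (le_of_eq ?_) (Finset.sum_le_sum fun k _ =>
        Finset.sum_le_sum fun l _ => hcross k l)
      simp only [Finset.sum_neg_distrib, Finset.sum_add_distrib, Finset.sum_const,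
        Finset.card_univ, Fintype.card_fin, nsmul_eq_mul, ← Finset.mul_sum]
      field_simp
    rw [hsplit]
    linarith
  have iw : Integrable (fun x => ∑ k, w.grad k x ^ 2) :=
    integrable_finsetSum _ fun k _ => (hgw k).integrable_sq
  have ip : Integrable (fun x => ∑ l, p l x ^ 2) :=
    integrable_finsetSum _ fun l _ => (memLp_indicator_harmonicGrad φ i l y R).integrable_sq
  have hint := integral_mono ((iw.const_mul (lam / 2)).sub (ip.const_mul (2 * d ^ 2 / lam)))
    (integrable_finsetSum _ fun k _ => (hF k).integrable_mul (hgw k)) hpoint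
  simp only [Pi.sub_apply, Pi.mul_apply] at hint
  rw [horth, integral_sub (iw.const_mul _) (ip.const_mul _), integral_const_mul,
    integral_const_mul, ← dirichletEnergy_eq_integral w hgw, integral_sum_indicator_sq] at hint
  have h6 : dirichletEnergy w = 2 / lam * (lam / 2 * dirichletEnergy w) := by field_simp
  have h7 : 4 * (d : ℝ) ^ 2 / lam ^ 2 = 2 / lam * (2 * d ^ 2 / lam) := by field_simp; ring
  rw [h6, h7, mul_assoc (2 / lam) (2 * d ^ 2 / lam)]
  exact mul_le_mul_of_nonneg_left (by linarith) (by positivity)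

/-- The flux perturbation is square integrable, with a bound by the energy of `x_i + φ_i` in the
defect. -/
theorem integral_sq_flux_sub_flux_le (hlam : 0 < lam) (ha : IsCoefficientField lam a)
    (ha₀ : IsCoefficientField lam a₀) (hφ : SolvesCorrectorEq a φ)
    (hφ' : SolvesCorrectorEq (defectMedium a a₀ y R) φ') {i : Fin d}
    (hi : SameAtInfinity (φ' i) (φ i)) (k : Fin d) :
    ∫ x, (flux (defectMedium a a₀ y R) φ' i k x - flux a φ i k x) ^ 2
      ≤ (8 * d ^ 3 / lam ^ 2 + 8 * d)
        * ∫ x in Metric.ball y R, ∑ l, harmonicGrad φ i l x ^ 2 := by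
  have ha' := ha.defectMedium ha₀ y R
  set w := (φ' i).sub (φ i) with hw
  set p : Fin d → Rd d → ℝ := fun l => (Metric.ball y R).indicator (harmonicGrad φ i l) with hp
  have hgw : ∀ k, MemLp (w.grad k) 2 volume := hi
  have iw : Integrable (fun x => ∑ k, w.grad k x ^ 2) :=
    integrable_finsetSum _ fun k _ => (hgw k).integrable_sq
  have ip : Integrable (fun x => ∑ l, p l x ^ 2) :=
    integrable_finsetSum _ fun l _ => (memLp_indicator_harmonicGrad φ i l y R).integrable_sq
  have hE := dirichletEnergy_corrector_le hlam ha ha₀ hφ hφ' hi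
  calc ∫ x, (flux (defectMedium a a₀ y R) φ' i k x - flux a φ i k x) ^ 2
      ≤ ∫ x, (2 * d * ∑ l, w.grad l x ^ 2 + 8 * d * ∑ l, p l x ^ 2) := by
        refine integral_mono (memLp_flux_sub_flux hlam ha ha₀ hi k).integrable_sq
          ((iw.const_mul _).add (ip.const_mul _)) fun x => ?_
        simp only [flux_sub_flux]
        refine (sq_sum_le_card_mul_sum_sq (s := Finset.univ)).trans ?_
        rw [Finset.card_univ, Fintype.card_fin]
        have hterm : ∀ l, (defectMedium a a₀ y R x k l * w.grad l x
            + (defectMedium a a₀ y R x k l - a x k l) * p l x) ^ 2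
            ≤ 2 * w.grad l x ^ 2 + 8 * p l x ^ 2 := by
          intro l
          have h1 : (defectMedium a a₀ y R x k l) ^ 2 ≤ 1 := by
            rw [← sq_abs]
            exact pow_le_one₀ (abs_nonneg _) (ha'.abs_le_one hlam x k l)
          have h2 : (defectMedium a a₀ y R x k l - a x k l) ^ 2 ≤ 2 ^ 2 := by
            rw [← sq_abs]
            exact pow_le_pow_left₀ (abs_nonneg _) (abs_defectMedium_sub_le hlam ha ha₀ x k l) 2
          refine add_sq_le.trans ?_
          rw [mul_pow, mul_pow]
          nlinarith [mul_le_mul_of_nonneg_right h1 (sq_nonneg (w.grad l x)),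
            mul_le_mul_of_nonneg_right h2 (sq_nonneg (p l x))]
        refine (mul_le_mul_of_nonneg_left (Finset.sum_le_sum fun l _ => hterm l)
          (Nat.cast_nonneg d)).trans_eq ?_
        rw [Finset.sum_add_distrib, ← Finset.mul_sum, ← Finset.mul_sum]
        ring
    _ = 2 * d * dirichletEnergy w
          + 8 * d * ∫ x in Metric.ball y R, ∑ l, harmonicGrad φ i l x ^ 2 := by
        rw [integral_add (iw.const_mul _) (ip.const_mul _), integral_const_mul,
          integral_const_mul, ← dirichletEnergy_eq_integral w hgw, integral_sum_indicator_sq]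
    _ ≤ 2 * d * (4 * d ^ 2 / lam ^ 2
            * ∫ x in Metric.ball y R, ∑ l, harmonicGrad φ i l x ^ 2)
          + 8 * d * ∫ x in Metric.ball y R, ∑ l, harmonicGrad φ i l x ^ 2 := by
        gcongr
    _ = _ := by ring

/-- The energy of `σ'_{ijk} - σ_{ijk}` is controlled by the flux perturbation. -/
theorem dirichletEnergy_fluxCorrector_le (hlam : 0 < lam) (ha : IsCoefficientField lam a)
    (ha₀ : IsCoefficientField lam a₀) {σ σ' : Fin d → Fin d → Fin d → H1loc d}
    (hσ : SolvesGaugeEq a φ σ) (hσ' : SolvesGaugeEq (defectMedium a a₀ y R) φ' σ')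
    {i : Fin d} (hi : SameAtInfinity (φ' i) (φ i)) {j k : Fin d}
    (hijk : SameAtInfinity (σ' i j k) (σ i j k)) :
    dirichletEnergy ((σ' i j k).sub (σ i j k))
      ≤ 2 * (∫ x, (flux (defectMedium a a₀ y R) φ' i j x - flux a φ i j x) ^ 2)
        + 2 * ∫ x, (flux (defectMedium a a₀ y R) φ' i k x - flux a φ i k x) ^ 2 := by
  have ha' := ha.defectMedium ha₀ y R
  set a' := defectMedium a a₀ y R with ha'def
  set w := (σ' i j k).sub (σ i j k) with hw
  have hgw : ∀ k, MemLp (w.grad k) 2 volume := hijk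
  set F : Fin d → Rd d → ℝ := fun k x => flux a' φ' i k x - flux a φ i k x with hFdef
  have hF : ∀ k, MemLp (F k) 2 volume := fun k => memLp_flux_sub_flux hlam ha ha₀ hi k
  -- the divergence-free field `∇w + F_k e_j - F_j e_k`
  set G : Fin d → Rd d → ℝ := fun l x =>
    w.grad l x + ((if l = j then F k x else 0) - (if l = k then F j x else 0)) with hG
  have hGm : ∀ l, MemLp (G l) 2 volume := by
    intro l
    refine (hgw l).add (MemLp.sub ?_ ?_)
    · by_cases h : l = j
      · simpa [h] using hF k
      · simp [h]
    · by_cases h : l = k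
      · simpa [h] using hF j
      · simp [h]
  have hGsum : ∀ (v : Fin d → ℝ) (x : Rd d), ∑ l, G l x * v l
      = ∑ l, w.grad l x * v l + (F k x * v j - F j x * v k) := by
    intro v x
    simp only [hG, add_mul, sub_mul, ite_mul, zero_mul, Finset.sum_add_distrib,
      Finset.sum_sub_distrib, Finset.sum_ite_eq', Finset.mem_univ, if_true]
  have horth := integral_divFree_mul_grad_eq_zero_of_memLp hGm (fun η hη => by
    have t1 : ∀ (u : H1loc d), Integrable (fun x => ∑ l, u.grad l x * pd l η x) := fun u =>
      integrable_finsetSum _ fun l _ => (u.grad_L2loc l).integrable_mul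
        (hη.pd l).continuous (hη.pd l).2
    have t2 : ∀ m l, Integrable (fun x => flux a' φ' i m x * pd l η x) := fun m l =>
      (ha'.l2loc_flux hlam φ' i m).integrable_mul (hη.pd l).continuous (hη.pd l).2
    have t3 : ∀ m l, Integrable (fun x => flux a φ i m x * pd l η x) := fun m l =>
      (ha.l2loc_flux hlam φ i m).integrable_mul (hη.pd l).continuous (hη.pd l).2
    have s1 := hσ' i j k η hη
    have s2 := hσ i j k η hη
    have t4 : Integrable fun x => flux a' φ' i k x * pd j η x - flux a' φ' i j x * pd k η x :=
      (t2 k j).sub (t2 j k)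
    have t5 : Integrable fun x => flux a φ i k x * pd j η x - flux a φ i j x * pd k η x :=
      (t3 k j).sub (t3 j k)
    have e : ∀ x, ∑ l, G l x * pd l η x
        = (∑ l, (σ' i j k).grad l x * pd l η x
            + (flux a' φ' i k x * pd j η x - flux a' φ' i j x * pd k η x))
          - (∑ l, (σ i j k).grad l x * pd l η x
            + (flux a φ i k x * pd j η x - flux a φ i j x * pd k η x)) := by
      intro x
      rw [hGsum (fun l => pd l η x)]
      simp only [hw, H1loc.sub, sub_mul, Finset.sum_sub_distrib, hFdef]
      ring
    simp_rw [e]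
    have t6 : Integrable fun x => ∑ l, (σ' i j k).grad l x * pd l η x
        + (flux a' φ' i k x * pd j η x - flux a' φ' i j x * pd k η x) := (t1 (σ' i j k)).add t4
    have t7 : Integrable fun x => ∑ l, (σ i j k).grad l x * pd l η x
        + (flux a φ i k x * pd j η x - flux a φ i j x * pd k η x) := (t1 (σ i j k)).add t5
    rw [integral_sub t6 t7, integral_add (t1 _) t4, integral_add (t1 _) t5, s1, s2]
    ring) w hgw
  have hpoint : ∀ x, 1 / 2 * ∑ l, w.grad l x ^ 2 - (F j x ^ 2 + F k x ^ 2)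
      ≤ ∑ l, G l x * w.grad l x := by
    intro x
    rw [hGsum (fun l => w.grad l x) x]
    have hj : w.grad j x ^ 2 ≤ ∑ l, w.grad l x ^ 2 :=
      Finset.single_le_sum (f := fun l => w.grad l x ^ 2) (fun _ _ => sq_nonneg _)
        (Finset.mem_univ j)
    have hk : w.grad k x ^ 2 ≤ ∑ l, w.grad l x ^ 2 :=
      Finset.single_le_sum (f := fun l => w.grad l x ^ 2) (fun _ _ => sq_nonneg _)
        (Finset.mem_univ k)
    have hs : ∑ l, w.grad l x * w.grad l x = ∑ l, w.grad l x ^ 2 :=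
      Finset.sum_congr rfl fun l _ => (sq _).symm
    rw [hs]
    nlinarith [sq_nonneg (F k x + w.grad j x / 2), sq_nonneg (F j x - w.grad k x / 2)]
  have iw : Integrable (fun x => ∑ k, w.grad k x ^ 2) :=
    integrable_finsetSum _ fun k _ => (hgw k).integrable_sq
  have iF : Integrable (fun x => F j x ^ 2 + F k x ^ 2) :=
    (hF j).integrable_sq.add (hF k).integrable_sq
  have hint := integral_mono ((iw.const_mul (1 / 2)).sub iF)
    (integrable_finsetSum _ fun l _ => (hGm l).integrable_mul (hgw l)) hpoint
  simp only [Pi.sub_apply, Pi.mul_apply] at hint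
  rw [horth, integral_sub (iw.const_mul _) iF, integral_const_mul,
    ← dirichletEnergy_eq_integral w hgw, integral_add (hF j).integrable_sq
    (hF k).integrable_sq] at hint
  linarith

end Corrector

/-! ### Growth of the perturbed corrector -/

/-- The unnormalised `L²` oscillation `∫_{B_r(z)} |u - ⨍ u|²`. -/
noncomputable def ballOsc (u : H1loc d) (z : Rd d) (r : ℝ) : ℝ :=
  ∫ x in Metric.ball z r, (u.toFun x - ballMean u z r) ^ 2

theorem ballOsc_nonneg (u : H1loc d) (z : Rd d) (r : ℝ) : 0 ≤ ballOsc u z r :=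
  integral_nonneg fun _ => sq_nonneg _

theorem integrable_sq_sub_const (u : H1loc d) (z : Rd d) (r c : ℝ) :
    Integrable (fun x => (u.toFun x - c) ^ 2) (volume.restrict (Metric.ball z r)) :=
  ((u.toFun_L2loc.sub (continuous_const (y := c)).l2loc).ball z r).integrable_sq

theorem ballOsc_le_two_mul_add (u v : H1loc d) (z : Rd d) (r : ℝ) :
    ballOsc v z r ≤ 2 * ballOsc u z r + 2 * ballOsc (v.sub u) z r := by
  have hfin : IsFiniteMeasure (volume.restrict (Metric.ball z r)) := ⟨by
    simpa using measure_ball_lt_top⟩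
  have hmean : ballMean (v.sub u) z r = ballMean v z r - ballMean u z r := by
    have e : ∫ x in Metric.ball z r, (v.sub u).toFun x
        = (∫ x in Metric.ball z r, v.toFun x) - ∫ x in Metric.ball z r, u.toFun x :=
      integral_sub ((v.toFun_L2loc.ball z r).integrable one_le_two)
        ((u.toFun_L2loc.ball z r).integrable one_le_two)
    rw [ballMean_eq, ballMean_eq, ballMean_eq, e, mul_sub]
  unfold ballOsc
  rw [← integral_const_mul, ← integral_const_mul, ← integral_add
    ((integrable_sq_sub_const u z r _).const_mul 2)
    ((integrable_sq_sub_const (v.sub u) z r _).const_mul 2)]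
  refine integral_mono (integrable_sq_sub_const v z r _)
    (((integrable_sq_sub_const u z r _).const_mul 2).add
    ((integrable_sq_sub_const (v.sub u) z r _).const_mul 2)) fun x => ?_
  have hsub : (v.sub u).toFun x = v.toFun x - u.toFun x := rfl
  simp only [hmean, hsub]
  nlinarith [sq_nonneg ((u.toFun x - ballMean u z r)
    - (v.toFun x - u.toFun x - (ballMean v z r - ballMean u z r)))]

/-- The sum of the oscillations of all components of `(φ, σ)`. -/
noncomputable def totalOsc (φ : Fin d → H1loc d) (σ : Fin d → Fin d → Fin d → H1loc d)
    (z : Rd d) (r : ℝ) : ℝ :=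
  ∑ i, ballOsc (φ i) z r + ∑ i, ∑ j, ∑ k, ballOsc (σ i j k) z r

theorem relOsc_nonneg (φ : Fin d → H1loc d) (σ : Fin d → Fin d → Fin d → H1loc d)
    (z : Rd d) {r : ℝ} (hr : 0 < r) : 0 ≤ relOsc φ σ z r :=
  mul_nonneg (by positivity) (Real.sqrt_nonneg _)

theorem relOsc_sq (φ : Fin d → H1loc d) (σ : Fin d → Fin d → Fin d → H1loc d)
    (z : Rd d) {r : ℝ} (hr : 0 < r) :
    relOsc φ σ z r ^ 2 = totalOsc φ σ z r / (r ^ 2 * volume.real (Metric.ball z r)) := by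
  have hv := volume_real_ball_pos z hr
  have e : ∫ x in Metric.ball z r, ((∑ i, ((φ i).toFun x - ballMean (φ i) z r) ^ 2) +
      ∑ i, ∑ j, ∑ k, ((σ i j k).toFun x - ballMean (σ i j k) z r) ^ 2) = totalOsc φ σ z r := by
    have t1 : Integrable (fun x => ∑ i, ((φ i).toFun x - ballMean (φ i) z r) ^ 2)
        (volume.restrict (Metric.ball z r)) :=
      integrable_finsetSum _ fun i _ => integrable_sq_sub_const (φ i) z r _
    have t2 : ∀ i j, Integrable (fun x => ∑ k, ((σ i j k).toFun x - ballMean (σ i j k) z r) ^ 2)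
        (volume.restrict (Metric.ball z r)) := fun i j =>
      integrable_finsetSum _ fun k _ => integrable_sq_sub_const (σ i j k) z r _
    have t3 : ∀ i, Integrable
        (fun x => ∑ j, ∑ k, ((σ i j k).toFun x - ballMean (σ i j k) z r) ^ 2)
        (volume.restrict (Metric.ball z r)) := fun i => integrable_finsetSum _ fun j _ => t2 i j
    rw [integral_add t1 (integrable_finsetSum _ fun i _ => t3 i),
      integral_finsetSum _ fun i _ => integrable_sq_sub_const (φ i) z r _,
      integral_finsetSum _ fun i _ => t3 i]
    unfold totalOsc ballOsc
    congr 1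
    refine Finset.sum_congr rfl fun i _ => ?_
    rw [integral_finsetSum _ fun j _ => t2 i j]
    refine Finset.sum_congr rfl fun j _ => ?_
    rw [integral_finsetSum _ fun k _ => integrable_sq_sub_const (σ i j k) z r _]
  have h0 : 0 ≤ totalOsc φ σ z r := by
    rw [← e]
    exact integral_nonneg fun x => add_nonneg (Finset.sum_nonneg fun _ _ => sq_nonneg _)
      (Finset.sum_nonneg fun _ _ => Finset.sum_nonneg fun _ _ =>
        Finset.sum_nonneg fun _ _ => sq_nonneg _)
  unfold relOsc
  rw [setAverage_eq, e, smul_eq_mul, mul_pow, Real.sq_sqrt (by positivity)]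
  field_simp

theorem ballOsc_le_totalOsc (φ : Fin d → H1loc d) (σ : Fin d → Fin d → Fin d → H1loc d)
    (i : Fin d) (z : Rd d) (r : ℝ) : ballOsc (φ i) z r ≤ totalOsc φ σ z r := by
  have h1 : ballOsc (φ i) z r ≤ ∑ i, ballOsc (φ i) z r :=
    Finset.single_le_sum (f := fun i => ballOsc (φ i) z r) (fun _ _ => ballOsc_nonneg _ _ _)
      (Finset.mem_univ i)
  have h2 : 0 ≤ ∑ i, ∑ j, ∑ k, ballOsc (σ i j k) z r := Finset.sum_nonneg fun _ _ =>
    Finset.sum_nonneg fun _ _ => Finset.sum_nonneg fun _ _ => ballOsc_nonneg _ _ _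
  unfold totalOsc
  linarith

/-- Above a radius of sublinear growth, the energy of the harmonic coordinates in a ball is bounded
by the volume. -/
theorem exists_energy_harmonicGrad_le (d : ℕ) {lam : ℝ} (hlam : 0 < lam) {β : ℝ} (hβ : 0 < β) :
    ∃ C : ℝ, 0 < C ∧ ∀ (a : Rd d → Matrix (Fin d) (Fin d) ℝ) (φ : Fin d → H1loc d)
      (σ : Fin d → Fin d → Fin d → H1loc d), IsCoefficientField lam a →
      SolvesCorrectorEq a φ → ∀ (z : Rd d) (ρ : ℝ), IsSublinearRadius β φ σ z ρ →
      ∀ s : ℝ, ρ ≤ s → ∀ i,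
      ∫ x in Metric.ball z s, ∑ l, harmonicGrad φ i l x ^ 2 ≤ C * s ^ d := by
  obtain ⟨C, hC, hcacc⟩ := exists_caccioppoli d hlam
  set v := volume.real (Metric.ball (0 : Rd d) 1) with hv
  have hv0 : 0 < v := volume_real_ball_pos 0 one_pos
  refine ⟨C * (16 * 2 ^ d * v), by positivity, fun a φ σ ha hφ z ρ hρ s hs i => ?_⟩
  have hs0 : 0 < s := hρ.1.trans_le hs
  have h2s : 0 < 2 * s := by positivity
  set B := Metric.ball z (2 * s) with hB
  have hvol : volume.real B = (2 * s) ^ d * v := volume_real_ball z h2s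
  have hfin : IsFiniteMeasure (volume.restrict B) := ⟨by simpa [hB] using measure_ball_lt_top⟩
  set m := ballMean (φ i) z (2 * s) with hm
  have hosc : ballOsc (φ i) z (2 * s) ≤ (2 * s) ^ 2 * volume.real B := by
    have h1 : relOsc φ σ z (2 * s) ≤ 1 := (hρ.2 (2 * s) (by linarith)).trans
      (Real.rpow_le_one (div_nonneg hρ.1.le h2s.le) ((div_le_one h2s).2 (by linarith)) hβ.le)
    have h2 : relOsc φ σ z (2 * s) ^ 2 ≤ 1 := pow_le_one₀ (relOsc_nonneg φ σ z h2s) h1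
    have hvB : 0 < volume.real B := volume_real_ball_pos z h2s
    rw [relOsc_sq φ σ z h2s, div_le_one (by positivity)] at h2
    exact (ballOsc_le_totalOsc φ σ i z (2 * s)).trans h2
  -- subtracting `z i + m` makes both `x i - z i` and `φ_i - m` of order `s` on `B_{2s}(z)`
  have hcut := hcacc a φ ha hφ i z s hs0 (z i + m)
  refine hcut.trans ?_
  have hle : ∫ x in B, (x i + (φ i).toFun x - (z i + m)) ^ 2 ≤ 16 * s ^ 2 * volume.real B := by
    have i1 : Integrable (fun x => 2 * (2 * s) ^ 2 + 2 * ((φ i).toFun x - m) ^ 2)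
        (volume.restrict B) :=
      (integrable_const _).add ((integrable_sq_sub_const (φ i) z (2 * s) m).const_mul 2)
    have hxc : Continuous fun x : Rd d => x i := by fun_prop
    have i2 : Integrable (fun x => (x i + (φ i).toFun x - (z i + m)) ^ 2) (volume.restrict B) :=
      (((hxc.l2loc.add (φ i).toFun_L2loc).sub
        (continuous_const (y := z i + m)).l2loc).ball z (2 * s)).integrable_sq
    calc ∫ x in B, (x i + (φ i).toFun x - (z i + m)) ^ 2
        ≤ ∫ x in B, (2 * (2 * s) ^ 2 + 2 * ((φ i).toFun x - m) ^ 2) := by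
          refine setIntegral_mono_on i2 i1 Metric.isOpen_ball.measurableSet fun x hx => ?_
          have h1 : |x i - z i| ≤ 2 * s := by
            have h2 := PiLp.norm_apply_le (x - z) i
            rw [← dist_eq_norm] at h2
            have h3 : |x i - z i| ≤ dist x z := by simpa using h2
            exact h3.trans (Metric.mem_ball.1 hx).le
          have h4 : (x i - z i) ^ 2 ≤ (2 * s) ^ 2 := by
            rw [← sq_abs]; exact pow_le_pow_left₀ (abs_nonneg _) h1 2
          nlinarith [sq_nonneg ((x i - z i) - ((φ i).toFun x - m))]
      _ = 2 * (2 * s) ^ 2 * volume.real B + 2 * ballOsc (φ i) z (2 * s) := by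
          rw [integral_add (integrable_const _)
            ((integrable_sq_sub_const (φ i) z (2 * s) m).const_mul 2), integral_const,
            integral_const_mul, measureReal_restrict_apply_univ, smul_eq_mul,
            mul_comm (volume.real B)]
          rfl
      _ ≤ 16 * s ^ 2 * volume.real B := by linarith
  calc C / s ^ 2 * ∫ x in B, (x i + (φ i).toFun x - (z i + m)) ^ 2
      ≤ C / s ^ 2 * (16 * s ^ 2 * volume.real B) := by gcongr
    _ = C * (16 * 2 ^ d * v) * s ^ d := by
        rw [hvol, mul_pow]; field_simp

/-- The perturbation changes every component of the augmented corrector by a function whose energy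
on the whole space is at most `C s^d`, for every radius `s` above `R` and above a radius of
sublinear growth at the centre of the defect. -/
theorem exists_dirichletEnergy_sub_le (d : ℕ) {lam : ℝ} (hlam : 0 < lam) {β : ℝ} (hβ : 0 < β) :
    ∃ C : ℝ, 0 < C ∧ ∀ (a a₀ : Rd d → Matrix (Fin d) (Fin d) ℝ)
      (ah : Matrix (Fin d) (Fin d) ℝ) (φ φ' : Fin d → H1loc d)
      (σ σ' : Fin d → Fin d → Fin d → H1loc d) (y : Rd d) (R : ℝ),
      IsCoefficientField lam a → IsCoefficientField lam a₀ → IsAugmentedCorrector a ah φ σ →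
      IsPerturbedCorrector (defectMedium a a₀ y R) φ σ φ' σ' →
      ∀ ρ, IsSublinearRadius β φ σ y ρ → ∀ s : ℝ, ρ ≤ s → R ≤ s →
      (∀ i, dirichletEnergy ((φ' i).sub (φ i)) ≤ C * s ^ d) ∧
      ∀ i j k, dirichletEnergy ((σ' i j k).sub (σ i j k)) ≤ C * s ^ d := by
  obtain ⟨C, hC, hen⟩ := exists_energy_harmonicGrad_le d hlam hβ
  set A : ℝ := 4 * d ^ 2 / lam ^ 2 with hA
  set A' : ℝ := 8 * d ^ 3 / lam ^ 2 + 8 * d with hA'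
  have hA0 : 0 ≤ A := by positivity
  have hA'0 : 0 ≤ A' := by positivity
  refine ⟨(A + 4 * A' + 1) * C, by positivity,
    fun a a₀ ah φ φ' σ σ' y R ha ha₀ hcorr hpert ρ hρ s hs hRs => ?_⟩
  have hs0 : 0 < s := hρ.1.trans_le hs
  have hφ := hcorr.solvesCorrectorEq
  have hP : ∀ i, ∫ x in Metric.ball y R, ∑ l, harmonicGrad φ i l x ^ 2 ≤ C * s ^ d := by
    intro i
    refine le_trans ?_ (hen a φ σ ha hφ y ρ hρ s hs i)
    refine setIntegral_mono_set ?_ (Filter.Eventually.of_forall fun x =>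
      Finset.sum_nonneg fun _ _ => sq_nonneg _) (Metric.ball_subset_ball hRs).eventuallyLE
    exact integrable_finsetSum _ fun l _ => ((l2loc_harmonicGrad φ i l).ball y s).integrable_sq
  have hCs : 0 ≤ C * s ^ d := by positivity
  have hq : ∀ i k, ∫ x, (flux (defectMedium a a₀ y R) φ' i k x - flux a φ i k x) ^ 2
      ≤ A' * (C * s ^ d) := fun i k =>
    (integral_sq_flux_sub_flux_le hlam ha ha₀ hφ hpert.corrector_eq
      (hpert.corrector_infty i) k).trans (mul_le_mul_of_nonneg_left (hP i) hA'0)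
  constructor
  · intro i
    refine (dirichletEnergy_corrector_le hlam ha ha₀ hφ hpert.corrector_eq
      (hpert.corrector_infty i)).trans ((mul_le_mul_of_nonneg_left (hP i) hA0).trans ?_)
    rw [mul_assoc (A + 4 * A' + 1)]
    gcongr
    linarith
  · intro i j k
    refine (dirichletEnergy_fluxCorrector_le hlam ha ha₀ hcorr.gauge hpert.gauge_eq
      (hpert.corrector_infty i) (hpert.gauge_infty i j k)).trans ?_
    have h1 := hq i j
    have h2 := hq i k
    have h3 : (A + 4 * A' + 1) * C * s ^ d
        = A * (C * s ^ d) + 4 * (A' * (C * s ^ d)) + C * s ^ d := by ring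
    have h4 : 0 ≤ A * (C * s ^ d) := mul_nonneg hA0 hCs
    linarith

/-- If every component of `(φ', σ') - (φ, σ)` has energy at most `E`, then the squared relative
oscillation increases by at most a term of order `E / r^d`, by the Poincaré inequality applied to
each of the `d + d^3` components. -/
theorem relOsc_sq_le_of_dirichletEnergy_le {φ φ' : Fin d → H1loc d}
    {σ σ' : Fin d → Fin d → Fin d → H1loc d} (hφ : ∀ i, SameAtInfinity (φ' i) (φ i))
    (hσ : ∀ i j k, SameAtInfinity (σ' i j k) (σ i j k)) {E : ℝ}
    (hEφ : ∀ i, dirichletEnergy ((φ' i).sub (φ i)) ≤ E)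
    (hEσ : ∀ i j k, dirichletEnergy ((σ' i j k).sub (σ i j k)) ≤ E) (z : Rd d) {r : ℝ}
    (hr : 0 < r) :
    relOsc φ' σ' z r ^ 2 ≤ 2 * relOsc φ σ z r ^ 2
      + 4 * (d + d ^ 3) * 2 ^ d * E / volume.real (Metric.ball z r) := by
  have hv := volume_real_ball_pos z hr
  set P := 2 * 2 ^ d * r ^ 2 * E with hP
  have hone : ∀ u v : H1loc d, SameAtInfinity v u → dirichletEnergy (v.sub u) ≤ E →
      ballOsc v z r ≤ 2 * ballOsc u z r + 2 * P := by
    intro u v huv hE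
    refine (ballOsc_le_two_mul_add u v z r).trans ?_
    have h1 : ballOsc (v.sub u) z r ≤ 2 * 2 ^ d * r ^ 2 * dirichletEnergy (v.sub u) :=
      poincare_ball (v.sub u) huv z hr
    have h2 : 2 * 2 ^ d * r ^ 2 * dirichletEnergy (v.sub u) ≤ P :=
      mul_le_mul_of_nonneg_left hE (by positivity)
    linarith
  have htot : totalOsc φ' σ' z r ≤ 2 * totalOsc φ σ z r + 2 * (d + d ^ 3) * P := by
    have h1 : ∑ i, ballOsc (φ' i) z r ≤ 2 * ∑ i, ballOsc (φ i) z r + d * (2 * P) := by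
      refine (Finset.sum_le_sum fun i _ => hone (φ i) (φ' i) (hφ i) (hEφ i)).trans_eq ?_
      simp [Finset.sum_add_distrib, Finset.mul_sum]
    have h2 : ∑ i, ∑ j, ∑ k, ballOsc (σ' i j k) z r
        ≤ 2 * ∑ i, ∑ j, ∑ k, ballOsc (σ i j k) z r + d * (d * (d * (2 * P))) := by
      refine (Finset.sum_le_sum fun i _ => Finset.sum_le_sum fun j _ => Finset.sum_le_sum
        fun k _ => hone (σ i j k) (σ' i j k) (hσ i j k) (hEσ i j k)).trans_eq ?_
      simp [Finset.sum_add_distrib, Finset.mul_sum]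
    unfold totalOsc
    linarith
  rw [relOsc_sq φ' σ' z hr, relOsc_sq φ σ z hr]
  calc totalOsc φ' σ' z r / (r ^ 2 * volume.real (Metric.ball z r))
      ≤ (2 * totalOsc φ σ z r + 2 * (d + d ^ 3) * P) / (r ^ 2 * volume.real (Metric.ball z r)) := by
        gcongr
    _ = _ := by
        rw [hP]; field_simp; ring

/-- Sublinear growth of `(φ, σ)` around `z` from `s` on turns into sublinear growth of
`(φ', σ')` from a multiple of `s` on; this uses `d / 2 ≥ 1 > β`. -/
theorem exists_isSublinearRadius_mul (d : ℕ) (hd : 2 ≤ d) {β : ℝ} (hβ : β ∈ Ioo (0 : ℝ) 1)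
    {C : ℝ} (hC : 0 < C) :
    ∃ K : ℝ, 0 < K ∧ ∀ (φ φ' : Fin d → H1loc d) (σ σ' : Fin d → Fin d → Fin d → H1loc d),
      (∀ i, SameAtInfinity (φ' i) (φ i)) → (∀ i j k, SameAtInfinity (σ' i j k) (σ i j k)) →
      ∀ s : ℝ, (∀ i, dirichletEnergy ((φ' i).sub (φ i)) ≤ C * s ^ d) →
      (∀ i j k, dirichletEnergy ((σ' i j k).sub (σ i j k)) ≤ C * s ^ d) →
      ∀ (z : Rd d) (ρ : ℝ), IsSublinearRadius β φ σ z ρ → ρ ≤ s →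
      IsSublinearRadius β φ' σ' z (K * s) := by
  set v := volume.real (Metric.ball (0 : Rd d) 1) with hv
  have hv0 : 0 < v := volume_real_ball_pos 0 one_pos
  set L : ℝ := 2 + 4 * (d + d ^ 3) * 2 ^ d * C / v with hL
  have hL1 : 1 ≤ L := by
    have : 0 ≤ 4 * ((d : ℝ) + d ^ 3) * 2 ^ d * C / v := by positivity
    linarith
  have hL0 : 0 < L := by linarith
  have hK1 : 1 ≤ L ^ (1 / β) := Real.one_le_rpow hL1 (one_div_pos.2 hβ.1).le
  -- the exponent makes `(K s / r)^β = L (s / r)^β`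
  refine ⟨L ^ (1 / β), by positivity, fun φ φ' σ σ' hφ hσ s hEφ hEσ z ρ hρ hρs => ?_⟩
  have hs0 : 0 < s := hρ.1.trans_le hρs
  refine ⟨by positivity, fun r hr => ?_⟩
  have hsr : s ≤ r := (le_mul_of_one_le_left hs0.le hK1).trans hr
  have hr0 : 0 < r := hs0.trans_le hsr
  have hq0 : 0 < s / r := div_pos hs0 hr0
  have hq1 : s / r ≤ 1 := (div_le_one hr0).2 hsr
  set X := (s / r) ^ β with hX
  have hX0 : 0 < X := Real.rpow_pos_of_pos hq0 β
  have h1 : relOsc φ σ z r ≤ X := (hρ.2 r (hρs.trans hsr)).trans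
    (Real.rpow_le_rpow (div_nonneg hρ.1.le hr0.le) (by gcongr) hβ.1.le)
  have h2 : relOsc φ σ z r ^ 2 ≤ X ^ 2 := pow_le_pow_left₀ (relOsc_nonneg φ σ z hr0) h1 2
  have h3 : (s / r) ^ d ≤ X ^ 2 := by
    calc (s / r) ^ d ≤ (s / r) ^ 2 := pow_le_pow_of_le_one hq0.le hq1 hd
      _ ≤ X ^ 2 := by
        refine pow_le_pow_left₀ hq0.le ?_ 2
        conv_lhs => rw [← Real.rpow_one (s / r)]
        exact Real.rpow_le_rpow_of_exponent_ge hq0 hq1 hβ.2.le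
  have h4 : relOsc φ' σ' z r ^ 2 ≤ L * X ^ 2 := by
    refine (relOsc_sq_le_of_dirichletEnergy_le hφ hσ hEφ hEσ z hr0).trans ?_
    have e : 4 * (d + d ^ 3) * 2 ^ d * (C * s ^ d) / volume.real (Metric.ball z r)
        = 4 * (d + d ^ 3) * 2 ^ d * C / v * (s / r) ^ d := by
      rw [volume_real_ball z hr0, ← hv, div_pow]
      field_simp
    rw [e, hL, add_mul]
    gcongr
  have h5 : (L ^ (1 / β) * s / r) ^ β = L * X := by
    rw [mul_div_assoc, Real.mul_rpow (by positivity) hq0.le, ← Real.rpow_mul hL0.le,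
      one_div_mul_cancel hβ.1.ne', Real.rpow_one]
  rw [h5]
  refine (sq_le_sq₀ (relOsc_nonneg φ' σ' z hr0) (by positivity)).1 ?_
  refine h4.trans ?_
  nlinarith [mul_le_mul_of_nonneg_right hL1 (mul_pos hL0 (pow_pos hX0 2)).le]

theorem exists_isSublinearRadius_lt {β : ℝ} {φ : Fin d → H1loc d}
    {σ : Fin d → Fin d → Fin d → H1loc d} {z : Rd d} (h : ∃ ρ, IsSublinearRadius β φ σ z ρ)
    {ε : ℝ} (hε : 0 < ε) :
    ∃ ρ, IsSublinearRadius β φ σ z ρ ∧ ρ < minimalRadius β φ σ z + ε :=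
  Real.lt_sInf_add_pos h hε

theorem IsSublinearRadius.minimalRadius_le {β : ℝ} {φ : Fin d → H1loc d}
    {σ : Fin d → Fin d → Fin d → H1loc d} {z : Rd d} {ρ : ℝ} (h : IsSublinearRadius β φ σ z ρ) :
    minimalRadius β φ σ z ≤ ρ := csInf_le ⟨0, fun _ h => h.1.le⟩ h

theorem lemma7 (d : ℕ) (hd : 2 ≤ d) (lam : ℝ) (hlam : 0 < lam) (β : ℝ) (hβ : β ∈ Set.Ioo (0 : ℝ) 1) :
    ∃ C : ℝ, 0 < C ∧
      ∀ (a : Rd d → Matrix (Fin d) (Fin d) ℝ) (_ : IsCoefficientField lam a)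
        (ah : Matrix (Fin d) (Fin d) ℝ)
        (φ : Fin d → H1loc d) (σ : Fin d → Fin d → Fin d → H1loc d)
        (_ : IsAugmentedCorrector a ah φ σ)
        (y : Rd d) (R : ℝ) (_ : 0 < R)
        (_ : ∃ ρ, IsSublinearRadius β φ σ 0 ρ) (_ : ∃ ρ, IsSublinearRadius β φ σ y ρ)
        (a₀ : Rd d → Matrix (Fin d) (Fin d) ℝ) (_ : IsCoefficientField lam a₀)
        (φ' : Fin d → H1loc d) (σ' : Fin d → Fin d → Fin d → H1loc d)
        (_ : IsPerturbedCorrector (defectMedium a a₀ y R) φ σ φ' σ'),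
        (∃ ρ, IsSublinearRadius β φ' σ' 0 ρ) ∧ (∃ ρ, IsSublinearRadius β φ' σ' y ρ) ∧
          minimalRadius β φ' σ' y + minimalRadius β φ' σ' 0 ≤
            C * (minimalRadius β φ σ y + minimalRadius β φ σ 0 + R) := by
  obtain ⟨C, hC, hen⟩ := exists_dirichletEnergy_sub_le d hlam hβ.1
  obtain ⟨K, hK, hrad⟩ := exists_isSublinearRadius_mul d hd hβ hC
  refine ⟨6 * K, by positivity, ?_⟩
  intro a ha ah φ σ hcorr y R hR h0 hy a₀ ha₀ φ' σ' hpert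
  -- the infima need not be attained, which costs another `2 R`
  obtain ⟨ρ0, hρ0, hlt0⟩ := exists_isSublinearRadius_lt h0 hR
  obtain ⟨ρy, hρy, hlty⟩ := exists_isSublinearRadius_lt hy hR
  have p0 := hρ0.1
  have py := hρy.1
  set s := ρy + ρ0 + R with hs
  obtain ⟨e1, e2⟩ := hen a a₀ ah φ φ' σ σ' y R ha ha₀ hcorr hpert ρy hρy s (by linarith)
    (by linarith)
  have g := hrad φ φ' σ σ' hpert.corrector_infty hpert.gauge_infty s e1 e2
  have g0 := g 0 ρ0 hρ0 (by linarith)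
  have gy := g y ρy hρy (by linarith)
  refine ⟨⟨_, g0⟩, ⟨_, gy⟩, ?_⟩
  have m0 : 0 ≤ minimalRadius β φ σ 0 := Real.sInf_nonneg fun _ h => h.1.le
  have my : 0 ≤ minimalRadius β φ σ y := Real.sInf_nonneg fun _ h => h.1.le
  calc minimalRadius β φ' σ' y + minimalRadius β φ' σ' 0 ≤ K * s + K * s :=
        add_le_add gy.minimalRadius_le g0.minimalRadius_le
    _ = 2 * K * s := by ring
    _ ≤ 2 * K * (3 * (minimalRadius β φ σ y + minimalRadius β φ σ 0 + R)) := by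
        gcongr
        linarith
    _ = _ := by ring
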